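/- Points of space-time are written $(x,t)\in\mathbb R^d\times\mathbb R$; $D_x^\alpha$ and $\nabla$ denote (weak) spatial derivatives and $\partial_t$ the (weak) time derivative. For an open set $W\subseteq\mathbb R^d\times\mathbb R$ and $k,l,m\in\mathbb N_0$ let $$\|w\|_{H^{k,l}(W)}^2=\sum_{|\alpha|/k+p/l\le 1}\|\partial_t^pD_x^\alpha w\|_{L^2(W)}^2,\qquad \|w\|_{H^{k,l,\infty}(W)}=\max_{|\alpha|/k+p/l\le 1}\|\partial_t^pD_x^\alpha w\|_{L^\infty(W)},$$ where $0/0=0$ and $q/0=\infty$ for $q>0$ (so $H^{0,l}$ involves only $\partial_t^p$, $p\le l$, and $H^{k,0}$ only $D_x^\alpha$, $|\alpha|\le k$), and $\|w\|_{H^m(W)}^2=\sum_{|\alpha|+p\le m}\|\partial_t^pD_x^\alpha w\|_{L^2(W)}^2$. A norm is $\infty$ if one of the weak derivatives does not exist. Let $d,l_s,l_t\in\mathbb N_0$ and $M,L\ge 0$. Consider an open set $E\subseteq\mathbb R^d\times\mathbb R$ and a map $\Psi:E\to\mathbb R^d$ such that $\Psi^{st}(x,t):=(\Psi(x,t),t)$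 is continuous on $E$, its image $\Psi^{st}(E)$ is open, and for every $t$ the map $\Psi(\cdot,t)$ is injective with $L$-Lipschitz inverse, i.e. $|x-y|\le L\,|\Psi(x,t)-\Psi(y,t)|$ for $(x,t),(y,t)\in E$. Let $u^e:\Psi^{st}(E)\to\mathbb R$. Then the following hold with constants $C$ that depend only on $d,l_s,l_t,M,L$ (and not on $E$, $\Psi$, $u^e$). 1. If $\|\Psi^{st}\|_{H^{0,l_t,\infty}(E)}\le M$, then $\|u^e\circ\Psi^{st}\|_{H^{0,l_t}(E)}\le C\,\|u^e\|_{H^{l_t}(\Psi^{st}(E))}$. 2. If $\|\Psi^{st}\|_{H^{l_s,0,\infty}(E)}\le M$, then $\|u^e\circ\Psi^{st}\|_{H^{l_s,0}(E)}\le C\,\|u^e\|_{H^{l_s}(\Psi^{st}(E))}$. 3. If $\|\Psi^{st}\|_{H^{l_s,0,\infty}(E)}+\|\partial_t\Psi^{st}\|_{H^{l_s,0,\infty}(E)}\le M$, then $\|\partial_t(u^e\circ\Psi^{st})\|_{H^{l_s,0}(E)}\le C\,\|u^e\|_{H^{l_s+1}(\Psi^{st}(E))}$. 4. If $\|\Psi^{st}\|_{H^{0,l_t,\infty}(E)}+\|\nabla\Psi^{st}\|_{H^{0,l_t,\infty}(E)}\le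 M$, then $\|\nabla(u^e\circ\Psi^{st})\|_{H^{0,l_t}(E)}\le C\,\|u^e\|_{H^{l_t+1}(\Psi^{st}(E))}$. -/

import Mathlib

open MeasureTheory Set
open scoped ENNReal NNReal ContDiff

noncomputable section

namespace AnisoSobolev

/-- Points `(x, t)` of space-time, with `d` space dimensions. -/
abbrev ST (d : ℕ) : Type := EuclideanSpace ℝ (Fin d) × ℝ

/-- A space-time multi-index `(α, p)` stands for the operator `∂ₜ^p D_x^α`. -/
abbrev MIdx (d : ℕ) : Type := (Fin d → ℕ) × ℕ

/-- The order `|α|` of the spatial part of a multi-index. -/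
def spaceOrder {d : ℕ} (a : MIdx d) : ℕ := ∑ i, a.1 i

/-- The total order `|α| + p`. -/
def totalOrder {d : ℕ} (a : MIdx d) : ℕ := spaceOrder a + a.2

/-- The multi-index of `∂ₜ`. -/
def idxT (d : ℕ) : MIdx d := (0, 1)

/-- The multi-index of `∂/∂xᵢ`. -/
def idxX {d : ℕ} (i : Fin d) : MIdx d := (Pi.single i 1, 0)

/-- Classical partial derivative in the direction `xᵢ`. -/
def partialX {d : ℕ} (i : Fin d) (g : ST d → ℝ) : ST d → ℝ :=
  fun z => fderiv ℝ g z (EuclideanSpace.single i 1, 0)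

/-- Classical partial derivative in time. -/
def partialT {d : ℕ} (g : ST d → ℝ) : ST d → ℝ :=
  fun z => fderiv ℝ g z (0, 1)

/-- The classical operator `D_x^α ∂ₜ^p`; it is applied to smooth functions only. -/
def classicalDeriv {d : ℕ} (a : MIdx d) (g : ST d → ℝ) : ST d → ℝ :=
  (List.finRange d).foldr (fun i f => (partialX i)^[a.1 i] f) (partialT^[a.2] g)

/-- `v` is the weak derivative `∂ₜ^p D_x^α w` on the open set `W`. -/
def HasWeakDeriv {d : ℕ} {F : Type*} [NormedAddCommGroup F] [NormedSpace ℝ F]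
    (W : Set (ST d)) (a : MIdx d) (w v : ST d → F) : Prop :=
  LocallyIntegrableOn w W ∧ LocallyIntegrableOn v W ∧
    ∀ φ : ST d → ℝ, ContDiff ℝ ∞ φ → HasCompactSupport φ → tsupport φ ⊆ W →
      ∫ z in W, classicalDeriv a φ z • w z = (-1 : ℝ) ^ totalOrder a • ∫ z in W, φ z • v z

/-- The `L^r(W)` norm of the weak derivative `∂ₜ^p D_x^α w`. It is `∞` if there is no such
derivative; as weak derivatives are unique almost everywhere, the infimum is over one value. -/
def weakDerivNorm {d : ℕ} {F : Type*} [NormedAddCommGroup F] [NormedSpace ℝ F]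
    (r : ℝ≥0∞) (W : Set (ST d)) (a : MIdx d) (w : ST d → F) : ℝ≥0∞ :=
  ⨅ (v : ST d → F) (_ : HasWeakDeriv W a w v), eLpNorm v r (volume.restrict W)

open Classical in
/-- The multi-indices with `|α| / k + p / l ≤ 1`. Division is that of `[0, ∞]`, where `0 / 0 = 0`
and `q / 0 = ∞` for `q > 0`: for `k = 0` there are no spatial derivatives, for `l = 0` no
temporal ones. The product only serves to bound the multi-indices a priori. -/
def anisoIdx (d k l : ℕ) : Finset (MIdx d) :=
  ((Fintype.piFinset fun _ : Fin d => Finset.range (k + 1)) ×ˢ Finset.range (l + 1)).filter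
    fun a => (spaceOrder a : ℝ≥0∞) / (k : ℝ≥0∞) + (a.2 : ℝ≥0∞) / (l : ℝ≥0∞) ≤ 1

/-- The multi-indices of total order at most `m`. -/
def isoIdx (d m : ℕ) : Finset (MIdx d) :=
  ((Fintype.piFinset fun _ : Fin d => Finset.range (m + 1)) ×ˢ Finset.range (m + 1)).filter
    fun a => totalOrder a ≤ m

/-- `(∑ ‖∂ₜ^p D_x^α w‖²_{L²(W)})^{1/2}` over the multi-indices in `S`; it is finite iff all
these weak derivatives exist and lie in `L²(W)`. -/
def normL2 {d : ℕ} {F : Type*} [NormedAddCommGroup F] [NormedSpace ℝ F]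
    (S : Finset (MIdx d)) (W : Set (ST d)) (w : ST d → F) : ℝ≥0∞ :=
  (∑ a ∈ S, weakDerivNorm 2 W a w ^ 2) ^ (1 / 2 : ℝ)

/-- `max ‖∂ₜ^p D_x^α w‖_{L^∞(W)}` over the multi-indices in `S`. -/
def normLinf {d : ℕ} {F : Type*} [NormedAddCommGroup F] [NormedSpace ℝ F]
    (S : Finset (MIdx d)) (W : Set (ST d)) (w : ST d → F) : ℝ≥0∞ :=
  S.sup fun a => weakDerivNorm ∞ W a w

/-- The norm of `H^m(W)`. -/
def normH {d : ℕ} (m : ℕ) (W : Set (ST d)) (w : ST d → ℝ) : ℝ≥0∞ :=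
  normL2 (isoIdx d m) W w

/-- The norm of the anisotropic space `H^{k,l}(W)`. -/
def normHaniso {d : ℕ} (k l : ℕ) (W : Set (ST d)) (w : ST d → ℝ) : ℝ≥0∞ :=
  normL2 (anisoIdx d k l) W w

/-- The norm of the weak time derivative `∂ₜ w` in `H^{k,l}(W)`. -/
def normHanisoDt {d : ℕ} (k l : ℕ) (W : Set (ST d)) (w : ST d → ℝ) : ℝ≥0∞ :=
  ⨅ (v : ST d → ℝ) (_ : HasWeakDeriv W (idxT d) w v), normHaniso k l W v

/-- The norm of the weak spatial gradient `∇ w` in `H^{k,l}(W)`. -/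
def normHanisoGrad {d : ℕ} (k l : ℕ) (W : Set (ST d)) (w : ST d → ℝ) : ℝ≥0∞ :=
  (∑ i : Fin d,
    (⨅ (v : ST d → ℝ) (_ : HasWeakDeriv W (idxX i) w v), normHaniso k l W v) ^ 2) ^ (1 / 2 : ℝ)

/-- The norm of `H^{k,l,∞}(W)`: as for `H^{k,l}(W)`, with `L^∞` in place of `L²`, for maps into
space-time. -/
def normHinf {d : ℕ} (k l : ℕ) (W : Set (ST d)) (w : ST d → ST d) : ℝ≥0∞ :=
  normLinf (anisoIdx d k l) W w

/-- The norm of the weak time derivative `∂ₜ w` in `H^{k,l,∞}(W)`. -/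
def normHinfDt {d : ℕ} (k l : ℕ) (W : Set (ST d)) (w : ST d → ST d) : ℝ≥0∞ :=
  ⨅ (v : ST d → ST d) (_ : HasWeakDeriv W (idxT d) w v), normHinf k l W v

/-- The norm of the weak spatial gradient `∇ w` in `H^{k,l,∞}(W)`. -/
def normHinfGrad {d : ℕ} (k l : ℕ) (W : Set (ST d)) (w : ST d → ST d) : ℝ≥0∞ :=
  Finset.univ.sup fun i : Fin d =>
    ⨅ (v : ST d → ST d) (_ : HasWeakDeriv W (idxX i) w v), normHinf k l W v

/-- The space-time variant `Ψˢᵗ(x, t) = (Ψ(x, t), t)` of a mapping `Ψ`. -/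
def spaceTimeMap {d : ℕ} (Ψ : ST d → EuclideanSpace ℝ (Fin d)) : ST d → ST d :=
  fun z => (Ψ z, z.2)

/-- `Ψˢᵗ` is a continuous map of the open set `E` onto an open set, and each `Ψ(·, t)` is
injective with an `L`-Lipschitz inverse. -/
structure IsDeformation {d : ℕ} (L : ℝ≥0) (E : Set (ST d))
    (Ψ : ST d → EuclideanSpace ℝ (Fin d)) : Prop where
  isOpen_domain : IsOpen E
  continuousOn : ContinuousOn (spaceTimeMap Ψ) E
  isOpen_image : IsOpen (spaceTimeMap Ψ '' E)
  antilipschitz : ∀ (t : ℝ) (x y : EuclideanSpace ℝ (Fin d)), (x, t) ∈ E → (y, t) ∈ E →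
    ‖x - y‖ ≤ L * ‖Ψ (x, t) - Ψ (y, t)‖

end AnisoSobolev

end

/-!
Weak derivatives are stable under local `L¹` convergence, so mollification transfers the product
rule to bounded functions with bounded weak derivatives, and the chain rule
`∂ᵥ (u ∘ Φ) = ∑ₑ (∂ᵥ Φ)ₑ • ((∂ₑ u) ∘ Φ)` to maps `Φ` with bounded weak derivative that distort
measure by at most a bounded factor: the latter is what makes `u ↦ u ∘ Φ` continuous in `L¹` and
`L²`. For `Ψˢᵗ` the factor is `L ^ d`, because `Ψˢᵗ` preserves time slices and its inverse is
`L`-Lipschitz on each of them.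

All four estimates then follow by induction on the order. The composite is differentiated only in
time or only in space; each differentiation turns it into a sum of products of a first derivative of
`Ψˢᵗ`, bounded together with its further derivatives in the same directions, and a composite
`(∂ₑ u) ∘ Ψˢᵗ`, whose outer function has one derivative less to spare. The mixed estimates 3 and 4
are the same statement after one derivative in the complementary direction.
-/

namespace AnisoSobolev

open Filter Topology Metric
open scoped Convolution

section Mollification

/-- A sequence of bump functions shrinking to the origin, with ratio `rOut / rIn` fixed to `2` so
that Lebesgue differentiation applies to it. -/
noncomputable def bumpSeq (G : Type*) [NormedAddCommGroup G] (n : ℕ) : ContDiffBump (0 : G) where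
  rIn := 1 / ((n : ℝ) + 1)
  rOut := 2 / ((n : ℝ) + 1)
  rIn_pos := by positivity
  rIn_lt_rOut := by gcongr; norm_num

lemma tendsto_rOut_bumpSeq {G : Type*} [NormedAddCommGroup G] :
    Tendsto (fun n => (bumpSeq G n).rOut) atTop (𝓝 0) := by
  simpa [bumpSeq, div_eq_mul_inv] using
    (tendsto_one_div_add_atTop_nhds_zero_nat (𝕜 := ℝ)).const_mul 2

lemma exists_compact_nhd_bumpSeq {G : Type*} [NormedAddCommGroup G] [NormedSpace ℝ G]
    [FiniteDimensional ℝ G] {K W : Set G} (hW : IsOpen W) (hK : IsCompact K) (hKW : K ⊆ W) :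
    ∃ K', IsCompact K' ∧ K ⊆ K' ∧ K' ⊆ W ∧
      ∃ N, ∀ n, ∀ x ∈ K, closedBall x (bumpSeq G (n + N)).rOut ⊆ K' := by
  obtain ⟨δ, hδ, hδW⟩ := hK.exists_cthickening_subset_open hW hKW
  obtain ⟨N, hN⟩ := eventually_atTop.1 ((tendsto_rOut_bumpSeq (G := G)).eventually_le_const hδ)
  refine ⟨cthickening δ K, hK.cthickening, self_subset_cthickening K, hδW, N, fun n x hx => ?_⟩
  exact (closedBall_subset_closedBall (hN _ (Nat.le_add_left N n))).trans
    (closedBall_subset_cthickening hx δ)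

variable {G : Type*} [NormedAddCommGroup G] [NormedSpace ℝ G] [MeasurableSpace G]
  {F : Type*} [NormedAddCommGroup F] [NormedSpace ℝ F]

/-- The convolution of `w` with a normalized bump function. -/
noncomputable def mollify [HasContDiffBump G] (μ : Measure G) (ρ : ContDiffBump (0 : G))
    (w : G → F) : G → F :=
  ρ.normed μ ⋆[ContinuousLinearMap.lsmul ℝ ℝ, μ] w

variable [FiniteDimensional ℝ G] [BorelSpace G] {μ : Measure G} [μ.IsAddHaarMeasure]
  {w h : G → F} {ρ : ContDiffBump (0 : G)}

lemma mollify_apply (x : G) : mollify μ ρ w x = ∫ y, ρ.normed μ (x - y) • w y ∂μ :=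
  convolution_lsmul_swap

lemma contDiff_mollify (hw : LocallyIntegrable w μ) : ContDiff ℝ ∞ (mollify μ ρ w) :=
  ρ.hasCompactSupport_normed.contDiff_convolution_left _ ρ.contDiff_normed hw

lemma mollify_add (hw : LocallyIntegrable w μ) (hh : LocallyIntegrable h μ) :
    mollify μ ρ (w + h) = mollify μ ρ w + mollify μ ρ h :=
  ConvolutionExists.distrib_add
    (ρ.hasCompactSupport_normed.convolutionExists_left _ ρ.continuous_normed hw)
    (ρ.hasCompactSupport_normed.convolutionExists_left _ ρ.continuous_normed hh)

lemma fderiv_mollify_apply (hw : LocallyIntegrable w μ) (x v : G) :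
    fderiv ℝ (mollify μ ρ w) x v = -∫ y, fderiv ℝ (fun y => ρ.normed μ (x - y)) y v • w y ∂μ := by
  have hρ : ContDiff ℝ ∞ (ρ.normed μ) := ρ.contDiff_normed
  have hderiv : HasFDerivAt (mollify μ ρ w) _ x :=
    ρ.hasCompactSupport_normed.hasFDerivAt_convolution_left (ContinuousLinearMap.lsmul ℝ ℝ)
      (hρ.of_le (by simp)) hw x
  have hexists := (ρ.hasCompactSupport_normed.fderiv ℝ).convolutionExists_left
    ((ContinuousLinearMap.lsmul ℝ ℝ).precompL G) (hρ.continuous_fderiv (by simp)) hw x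
  have hreflect (y : G) : fderiv ℝ (fun y => ρ.normed μ (x - y)) y v =
      -fderiv ℝ (ρ.normed μ) (x - y) v := by
    have := ((hρ.differentiable (by simp) (x - y)).hasFDerivAt.comp y
      ((hasFDerivAt_id y).const_sub x)).fderiv
    simpa [Function.comp_def] using DFunLike.congr_fun this v
  calc fderiv ℝ (mollify μ ρ w) x v
      = ∫ t, fderiv ℝ (ρ.normed μ) t v • w (x - t) ∂μ := by
        rw [hderiv.fderiv, convolution_def, ContinuousLinearMap.integral_apply hexists]
        rfl
    _ = ∫ y, fderiv ℝ (ρ.normed μ) (x - y) v • w y ∂μ :=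
        convolution_lsmul_swap (f := fun t => fderiv ℝ (ρ.normed μ) t v)
    _ = -∫ y, fderiv ℝ (fun y => ρ.normed μ (x - y)) y v • w y ∂μ := by
        simp [hreflect, integral_neg]

lemma norm_mollify_le {B : ℝ} (hw : ∀ᵐ y ∂μ, ‖w y‖ ≤ B) (x : G) : ‖mollify μ ρ w x‖ ≤ B := by
  calc ‖mollify μ ρ w x‖ ≤ ∫ t, ρ.normed μ t * B ∂μ := by
        refine norm_integral_le_of_norm_le (ρ.integrable_normed.mul_const B) ?_
        filter_upwards [(quasiMeasurePreserving_sub_left μ x).ae hw] with t ht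
        rw [ContinuousLinearMap.lsmul_apply, norm_smul, Real.norm_of_nonneg (ρ.nonneg_normed t)]
        exact mul_le_mul_of_nonneg_left ht (ρ.nonneg_normed t)
    _ = B := by rw [integral_mul_const, ρ.integral_normed, one_mul]

lemma ae_tendsto_mollify [CompleteSpace F] (hw : LocallyIntegrable w μ) :
    ∀ᵐ x ∂μ, Tendsto (fun n => mollify μ (bumpSeq G n) w x) atTop (𝓝 (w x)) :=
  ContDiffBump.ae_convolution_tendsto_right_of_locallyIntegrable (K := 2) tendsto_rOut_bumpSeq
    (.of_forall fun n => by simp [bumpSeq, div_eq_mul_inv]) hw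

lemma lintegral_enorm_mollify_le (hw : AEStronglyMeasurable w μ) :
    ∫⁻ x, ‖mollify μ ρ w x‖ₑ ∂μ ≤ ∫⁻ x, ‖w x‖ₑ ∂μ := by
  have integral_normed : ∫⁻ t, ‖ρ.normed μ t‖ₑ ∂μ = 1 := by
    rw [← ofReal_integral_norm_eq_lintegral_enorm ρ.integrable_normed]
    simp [abs_of_nonneg (ρ.nonneg_normed _), ρ.integral_normed]
  calc ∫⁻ x, ‖mollify μ ρ w x‖ₑ ∂μ
      ≤ ∫⁻ x, ∫⁻ t, ‖ρ.normed μ t‖ₑ * ‖w (x - t)‖ₑ ∂μ ∂μ :=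
        lintegral_mono fun x =>
          (enorm_integral_le_lintegral_enorm _).trans_eq (by simp [enorm_smul])
    _ = ∫⁻ t, ∫⁻ x, ‖ρ.normed μ t‖ₑ * ‖w (x - t)‖ₑ ∂μ ∂μ := by
        refine lintegral_lintegral_swap (AEMeasurable.mul (M := ℝ≥0∞) ?_ ?_)
        · exact (ρ.continuous_normed.measurable.comp measurable_snd).enorm.aemeasurable
        · exact (hw.comp_quasiMeasurePreserving
            (quasiMeasurePreserving_sub_of_right_invariant μ μ)).enorm
    _ = ∫⁻ t, ‖ρ.normed μ t‖ₑ * ∫⁻ x, ‖w x‖ₑ ∂μ ∂μ := by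
        refine lintegral_congr fun t => ?_
        rw [lintegral_const_mul' _ _ enorm_ne_top, lintegral_sub_right_eq_self fun x => ‖w x‖ₑ]
    _ = ∫⁻ x, ‖w x‖ₑ ∂μ := by
        rw [lintegral_mul_const'' _ ρ.continuous_normed.measurable.enorm.aemeasurable,
          integral_normed, one_mul]

lemma eventually_enorm_mollify_sub_le [CompleteSpace F] (hw : Continuous w)
    (hcs : HasCompactSupport w) {η : ℝ≥0} (hη : 0 < η) :
    ∀ᶠ n in atTop, ∀ x, ‖mollify μ (bumpSeq G n) w x - w x‖ₑ ≤ η := by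
  obtain ⟨δ, hδ, hwδ⟩ := Metric.uniformContinuous_iff.1
    (hcs.uniformContinuous_of_continuous hw) η hη
  filter_upwards [(tendsto_rOut_bumpSeq (G := G)).eventually_lt_const hδ] with n hn x
  rw [← edist_eq_enorm_sub, edist_le_coe]
  exact ContDiffBump.dist_normed_convolution_le hw.aestronglyMeasurable fun z hz =>
    (hwδ (lt_trans hz hn)).le

lemma setLIntegral_enorm_mollify_sub_le {η : ℝ≥0∞} (K : Set G) (hw : Integrable w μ)
    (hh : Integrable h μ) (hη : ∀ x, ‖mollify μ ρ h x - h x‖ₑ ≤ η) :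
    ∫⁻ x in K, ‖mollify μ ρ w x - w x‖ₑ ∂μ ≤ 2 * ∫⁻ x, ‖w x - h x‖ₑ ∂μ + η * μ K := by
  have hwh : AEStronglyMeasurable (w - h) μ := (hw.sub hh).aestronglyMeasurable
  have pointwise (x : G) : ‖mollify μ ρ w x - w x‖ₑ ≤
      ‖mollify μ ρ (w - h) x‖ₑ + ‖w x - h x‖ₑ + η := by
    have hsplit : mollify μ ρ w x - w x =
        mollify μ ρ (w - h) x - (w x - h x) + (mollify μ ρ h x - h x) := by
      nth_rewrite 1 [← sub_add_cancel w h]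
      rw [mollify_add (hw.sub hh).locallyIntegrable hh.locallyIntegrable, Pi.add_apply]
      abel
    rw [hsplit]
    exact (enorm_add_le _ _).trans (add_le_add enorm_sub_le (hη x))
  calc ∫⁻ x in K, ‖mollify μ ρ w x - w x‖ₑ ∂μ
      ≤ ∫⁻ x in K, (‖mollify μ ρ (w - h) x‖ₑ + ‖w x - h x‖ₑ + η) ∂μ := lintegral_mono pointwise
    _ = (∫⁻ x in K, ‖mollify μ ρ (w - h) x‖ₑ ∂μ) + (∫⁻ x in K, ‖w x - h x‖ₑ ∂μ) + η * μ K := by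
        have hmeas : AEMeasurable (fun x => ‖w x - h x‖ₑ) (μ.restrict K) := hwh.restrict.enorm
        rw [lintegral_add_right _ measurable_const, lintegral_add_right' _ hmeas,
          setLIntegral_const]
    _ ≤ (∫⁻ x, ‖w x - h x‖ₑ ∂μ) + (∫⁻ x, ‖w x - h x‖ₑ ∂μ) + η * μ K := by
        gcongr ?_ + ?_ + _
        · exact (setLIntegral_le_lintegral _ _).trans (lintegral_enorm_mollify_le hwh)
        · exact setLIntegral_le_lintegral _ _
    _ = 2 * ∫⁻ x, ‖w x - h x‖ₑ ∂μ + η * μ K := by rw [two_mul]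

lemma tendsto_setLIntegral_enorm_mollify_sub [CompleteSpace F] {K : Set G} (hK : μ K ≠ ⊤)
    (hw : Integrable w μ) :
    Tendsto (fun n => ∫⁻ x in K, ‖mollify μ (bumpSeq G n) w x - w x‖ₑ ∂μ) atTop (𝓝 0) := by
  refine ENNReal.tendsto_nhds_zero.2 fun ε hε => ?_
  have hV : 2 + μ K ≠ ⊤ := by simp [hK]
  obtain ⟨η, hη, hηε⟩ := ENNReal.lt_iff_exists_nnreal_btwn.1 (ENNReal.div_pos hε.ne' hV)
  obtain ⟨h, hcs, hwh, hc, hh⟩ := hw.exists_hasCompactSupport_lintegral_sub_le hη.ne'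
  filter_upwards [eventually_enorm_mollify_sub_le (μ := μ) hc hcs (by simpa using hη)] with n hn
  calc ∫⁻ x in K, ‖mollify μ (bumpSeq G n) w x - w x‖ₑ ∂μ
      ≤ 2 * ∫⁻ x, ‖w x - h x‖ₑ ∂μ + η * μ K := setLIntegral_enorm_mollify_sub_le K hw hh hn
    _ ≤ 2 * η + η * μ K := by gcongr
    _ = η * (2 + μ K) := by ring
    _ ≤ ε := (ENNReal.le_div_iff_mul_le (.inl (by simp)) (.inl hV)).1 hηε.le

end Mollification

section WeakDirectionalDerivatives

lemma setIntegral_smul_eq_of_support_subset {X F : Type*} [MeasurableSpace X]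
    [NormedAddCommGroup F] [NormedSpace ℝ F] {μ : Measure X} {K W : Set X} {a : X → ℝ} {f : X → F}
    (hW : Function.support a ⊆ W) (hK : Function.support a ⊆ K) :
    ∫ z in W, a z • f z ∂μ = ∫ z in K, a z • f z ∂μ := by
  have vanishing {S : Set X} (hS : Function.support a ⊆ S) (z : X) (hz : z ∉ S) :
      a z • f z = 0 := by rw [Function.notMem_support.1 (notMem_subset hS hz), zero_smul]
  rw [setIntegral_eq_integral_of_forall_compl_eq_zero (vanishing hW),
    setIntegral_eq_integral_of_forall_compl_eq_zero (vanishing hK)]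

variable {G : Type*} [NormedAddCommGroup G] [NormedSpace ℝ G] [MeasurableSpace G]
  {F : Type*} [NormedAddCommGroup F] [NormedSpace ℝ F]

/-- `g` is the weak derivative of `f` in the direction `v` on `W`. -/
structure IsWeakDirDeriv (μ : Measure G) (W : Set G) (v : G) (f g : G → F) : Prop where
  locallyIntegrableOn : LocallyIntegrableOn f W μ
  locallyIntegrableOn_deriv : LocallyIntegrableOn g W μ
  integral_eq : ∀ φ : G → ℝ, ContDiff ℝ ∞ φ → HasCompactSupport φ → tsupport φ ⊆ W →
    ∫ z in W, fderiv ℝ φ z v • f z ∂μ = -∫ z in W, φ z • g z ∂μ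

variable {μ : Measure G} {K W : Set G} {v : G} {f g : G → F}

lemma IsWeakDirDeriv.setIntegral_eq (h : IsWeakDirDeriv μ W v f g) {φ : G → ℝ}
    (hφ : ContDiff ℝ ∞ φ) (hc : HasCompactSupport φ) (hK : tsupport φ ⊆ K) (hKW : K ⊆ W) :
    ∫ z in K, fderiv ℝ φ z v • f z ∂μ = -∫ z in K, φ z • g z ∂μ := by
  have support_fderiv := subset_closure.trans (tsupport_fderiv_apply_subset (f := φ) ℝ v)
  rw [← setIntegral_smul_eq_of_support_subset ((support_fderiv.trans hK).trans hKW)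
    (support_fderiv.trans hK), h.integral_eq φ hφ hc (hK.trans hKW),
    setIntegral_smul_eq_of_support_subset ((subset_closure.trans hK).trans hKW)
      (subset_closure.trans hK)]

lemma IsWeakDirDeriv.of_setIntegral_tsupport_eq (hf : LocallyIntegrableOn f W μ)
    (hg : LocallyIntegrableOn g W μ)
    (h : ∀ φ : G → ℝ, ContDiff ℝ ∞ φ → HasCompactSupport φ → tsupport φ ⊆ W →
      ∫ z in tsupport φ, fderiv ℝ φ z v • f z ∂μ = -∫ z in tsupport φ, φ z • g z ∂μ) :
    IsWeakDirDeriv μ W v f g := by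
  refine ⟨hf, hg, fun φ hφ hc hs => ?_⟩
  have support_fderiv := subset_closure.trans (tsupport_fderiv_apply_subset (f := φ) ℝ v)
  rw [setIntegral_smul_eq_of_support_subset (support_fderiv.trans hs) support_fderiv,
    h φ hφ hc hs,
    setIntegral_smul_eq_of_support_subset (subset_closure.trans hs) (subset_tsupport φ)]

variable [FiniteDimensional ℝ G] [BorelSpace G] [μ.IsAddHaarMeasure]

lemma IsWeakDirDeriv.fderiv_mollify_indicator {ρ : ContDiffBump (0 : G)} {x : G}
    (h : IsWeakDirDeriv μ W v f g) (hK : IsCompact K) (hKW : K ⊆ W)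
    (hx : closedBall x ρ.rOut ⊆ K) :
    fderiv ℝ (mollify μ ρ (K.indicator f)) x v = mollify μ ρ (K.indicator g) x := by
  have integrable_indicator : Integrable (K.indicator f) μ :=
    (integrable_indicator_iff hK.measurableSet).2
      (h.locallyIntegrableOn.integrableOn_compact_subset hKW hK)
  have integral_smul_indicator (a : G → ℝ) (w : G → F) :
      ∫ y, a y • K.indicator w y ∂μ = ∫ y in K, a y • w y ∂μ := by
    simp_rw [← integral_indicator hK.measurableSet, ← indicator_smul_apply]
  have contDiff : ContDiff ℝ ∞ fun y => ρ.normed μ (x - y) :=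
    ρ.contDiff_normed.comp (contDiff_const.sub contDiff_id)
  have tsupport_subset : tsupport (fun y => ρ.normed μ (x - y)) ⊆ closedBall x ρ.rOut := by
    refine closure_minimal (fun y hy => ?_) isClosed_closedBall
    have hxy : x - y ∈ ball 0 ρ.rOut := ρ.support_normed_eq (μ := μ) ▸ hy
    rw [mem_closedBall, dist_comm, dist_eq_norm]
    exact (mem_ball_zero_iff.1 hxy).le
  rw [fderiv_mollify_apply integrable_indicator.locallyIntegrable, mollify_apply,
    integral_smul_indicator, integral_smul_indicator,
    h.setIntegral_eq contDiff (.of_support_subset_isCompact hK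
      (subset_closure.trans (tsupport_subset.trans hx))) (tsupport_subset.trans hx) hKW, neg_neg]

lemma IsWeakDirDeriv.exists_contDiff_approx_of_ae_bounded [CompleteSpace F]
    (h : IsWeakDirDeriv μ W v f g) (hW : IsOpen W) (hK : IsCompact K) (hKW : K ⊆ W) {B B' : ℝ≥0}
    (hf : ∀ᵐ x ∂μ.restrict W, ‖f x‖ ≤ B) (hg : ∀ᵐ x ∂μ.restrict W, ‖g x‖ ≤ B') :
    ∃ s : ℕ → G → F, (∀ n, ContDiff ℝ ∞ (s n)) ∧ (∀ n x, ‖s n x‖ ≤ B) ∧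
      (∀ n, ∀ x ∈ K, ‖fderiv ℝ (s n) x v‖ ≤ B') ∧
      (∀ᵐ x ∂μ.restrict K, Tendsto (fun n => s n x) atTop (𝓝 (f x))) ∧
      (∀ᵐ x ∂μ.restrict K, Tendsto (fun n => fderiv ℝ (s n) x v) atTop (𝓝 (g x))) := by
  obtain ⟨K', hK', hKK', hK'W, N, hN⟩ := exists_compact_nhd_bumpSeq hW hK hKW
  have fderiv_eq (n : ℕ) (x : G) (hx : x ∈ K) :=
    h.fderiv_mollify_indicator hK' hK'W (hN n x hx)
  have integrable_indicator {w : G → F} (hw : LocallyIntegrableOn w W μ) :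
      Integrable (K'.indicator w) μ := (integrable_indicator_iff hK'.measurableSet).2
    (hw.integrableOn_compact_subset hK'W hK')
  have norm_le {w : G → F} {C : ℝ≥0} (hw : ∀ᵐ x ∂μ.restrict W, ‖w x‖ ≤ C) :
      ∀ᵐ x ∂μ, ‖K'.indicator w x‖ ≤ C := by
    filter_upwards [(ae_restrict_iff' hK'.measurableSet).1
      (ae_restrict_of_ae_restrict_of_subset hK'W hw)] with x hx
    by_cases hxK : x ∈ K' <;> simp [hxK, hx]
  have tendsto {w : G → F} (hw : LocallyIntegrableOn w W μ) : ∀ᵐ x ∂μ.restrict K,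
      Tendsto (fun n => mollify μ (bumpSeq G (n + N)) (K'.indicator w) x) atTop (𝓝 (w x)) := by
    filter_upwards [ae_restrict_mem hK.measurableSet,
      ae_restrict_of_ae (ae_tendsto_mollify (integrable_indicator hw).locallyIntegrable)]
      with x hxK hx
    rw [indicator_of_mem (hKK' hxK)] at hx
    exact (tendsto_add_atTop_iff_nat N).2 hx
  refine ⟨fun n => mollify μ (bumpSeq G (n + N)) (K'.indicator f),
    fun n => contDiff_mollify (integrable_indicator h.locallyIntegrableOn).locallyIntegrable,
    fun n => norm_mollify_le (norm_le hf), fun n x hx => ?_, tendsto h.locallyIntegrableOn, ?_⟩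
  · rw [fderiv_eq n x hx]
    exact norm_mollify_le (norm_le hg) x
  · filter_upwards [tendsto h.locallyIntegrableOn_deriv, ae_restrict_mem hK.measurableSet]
      with x hx hxK
    simpa only [fderiv_eq _ x hxK] using hx

lemma exists_contDiff_approx_lintegral [CompleteSpace F] {ι : Type*} {e : ι → G} {g : ι → G → F}
    (hf : LocallyIntegrableOn f W μ) (h : ∀ j, IsWeakDirDeriv μ W (e j) f (g j)) (hW : IsOpen W)
    (hK : IsCompact K) (hKW : K ⊆ W) :
    ∃ s : ℕ → G → F, (∀ n, ContDiff ℝ ∞ (s n)) ∧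
      Tendsto (fun n => ∫⁻ x in K, ‖s n x - f x‖ₑ ∂μ) atTop (𝓝 0) ∧
      ∀ j, Tendsto (fun n => ∫⁻ x in K, ‖fderiv ℝ (s n) x (e j) - g j x‖ₑ ∂μ) atTop (𝓝 0) := by
  obtain ⟨K', hK', hKK', hK'W, N, hN⟩ := exists_compact_nhd_bumpSeq hW hK hKW
  have integrable_indicator {w : G → F} (hw : LocallyIntegrableOn w W μ) :
      Integrable (K'.indicator w) μ := (integrable_indicator_iff hK'.measurableSet).2
    (hw.integrableOn_compact_subset hK'W hK')
  have tendsto {w : G → F} (hw : LocallyIntegrableOn w W μ) : Tendsto (fun n =>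
      ∫⁻ x in K, ‖mollify μ (bumpSeq G (n + N)) (K'.indicator w) x - w x‖ₑ ∂μ) atTop (𝓝 0) := by
    refine ((tendsto_add_atTop_iff_nat N).2 (tendsto_setLIntegral_enorm_mollify_sub
      hK.measure_lt_top.ne (integrable_indicator hw))).congr fun n => ?_
    refine setLIntegral_congr_fun hK.measurableSet fun x hx => ?_
    simp only [indicator_of_mem (hKK' hx)]
  refine ⟨fun n => mollify μ (bumpSeq G (n + N)) (K'.indicator f),
    fun n => contDiff_mollify (integrable_indicator hf).locallyIntegrable, tendsto hf,
    fun j => (tendsto (h j).locallyIntegrableOn_deriv).congr fun n => ?_⟩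
  refine setLIntegral_congr_fun hK.measurableSet fun x hx => ?_
  simp only [(h j).fderiv_mollify_indicator hK' hK'W (hN n x hx)]

end WeakDirectionalDerivatives

section Limits

variable {X F : Type*} [MeasurableSpace X] [NormedAddCommGroup F] {μ : Measure X}
  {a : ℕ → X → F} {f : X → F}

lemma tendsto_lintegral_enorm_sub_of_dominated {bound : X → ℝ}
    (hmeas : ∀ n, AEStronglyMeasurable (a n) μ) (hbound : Integrable bound μ)
    (hle : ∀ n, ∀ᵐ x ∂μ, ‖a n x‖ ≤ bound x)
    (hlim : ∀ᵐ x ∂μ, Tendsto (fun n => a n x) atTop (𝓝 (f x))) :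
    Tendsto (fun n => ∫⁻ x, ‖a n x - f x‖ₑ ∂μ) atTop (𝓝 0) := by
  simpa only [ofReal_norm] using
    tendsto_lintegral_norm_of_dominated_convergence hmeas hbound.hasFiniteIntegral hle hlim

variable [NormedSpace ℝ F] {m : X → ℝ} {C : ℝ≥0}

lemma lintegral_enorm_smul_le {w : X → F} (hC : ∀ᵐ x ∂μ, ‖m x‖ ≤ C) :
    ∫⁻ x, ‖m x • w x‖ₑ ∂μ ≤ C * ∫⁻ x, ‖w x‖ₑ ∂μ := by
  rw [← lintegral_const_mul' _ _ ENNReal.coe_ne_top]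
  refine lintegral_mono_ae ?_
  filter_upwards [hC] with x hx
  rw [enorm_smul]
  gcongr
  exact enorm_le_coe.2 hx

lemma tendsto_integral_smul_of_L1 (hm : AEStronglyMeasurable m μ) (hC : ∀ᵐ x ∂μ, ‖m x‖ ≤ C)
    (ha : ∀ n, Integrable (a n) μ) (hf : AEStronglyMeasurable f μ)
    (hlim : Tendsto (fun n => ∫⁻ x, ‖a n x - f x‖ₑ ∂μ) atTop (𝓝 0)) :
    Tendsto (fun n => ∫ x, m x • a n x ∂μ) atTop (𝓝 (∫ x, m x • f x ∂μ)) := by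
  refine tendsto_integral_of_L1 (fun x => m x • f x) (hm.smul hf)
    (.of_forall fun n => (ha n).bdd_smul C hm hC) ?_
  have upper : Tendsto (fun n => C * ∫⁻ x, ‖a n x - f x‖ₑ ∂μ) atTop (𝓝 0) := by
    simpa using ENNReal.Tendsto.const_mul hlim (.inr (ENNReal.coe_ne_top (r := C)))
  refine tendsto_of_tendsto_of_tendsto_of_le_of_le tendsto_const_nhds upper (fun _ => zero_le)
    fun n => ?_
  simpa only [← smul_sub] using
    lintegral_enorm_smul_le (w := fun x => a n x - f x) hC

lemma tendsto_lintegral_enorm_sum_smul_sub {ι : Type*} [Fintype ι] {m : ι → X → ℝ} {C : ι → ℝ≥0}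
    {a : ι → ℕ → X → F} {f : ι → X → F} (hm : ∀ j, AEStronglyMeasurable (m j) μ)
    (hC : ∀ j, ∀ᵐ x ∂μ, ‖m j x‖ ≤ C j) (ha : ∀ j n, AEStronglyMeasurable (a j n) μ)
    (hf : ∀ j, AEStronglyMeasurable (f j) μ)
    (hlim : ∀ j, Tendsto (fun n => ∫⁻ x, ‖a j n x - f j x‖ₑ ∂μ) atTop (𝓝 0)) :
    Tendsto (fun n => ∫⁻ x, ‖∑ j, m j x • a j n x - ∑ j, m j x • f j x‖ₑ ∂μ) atTop (𝓝 0) := by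
  have upper : Tendsto (fun n => ∑ j, C j * ∫⁻ x, ‖a j n x - f j x‖ₑ ∂μ) atTop (𝓝 0) := by
    simpa using tendsto_finsetSum Finset.univ fun j _ =>
      ENNReal.Tendsto.const_mul (hlim j) (.inr (ENNReal.coe_ne_top (r := C j)))
  refine tendsto_of_tendsto_of_tendsto_of_le_of_le tendsto_const_nhds upper (fun _ => zero_le)
    fun n => ?_
  calc ∫⁻ x, ‖∑ j, m j x • a j n x - ∑ j, m j x • f j x‖ₑ ∂μ
      ≤ ∫⁻ x, ∑ j, ‖m j x • (a j n x - f j x)‖ₑ ∂μ := lintegral_mono fun x => by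
        simp only [← Finset.sum_sub_distrib, ← smul_sub]
        exact enorm_sum_le _ _
    _ = ∑ j, ∫⁻ x, ‖m j x • (a j n x - f j x)‖ₑ ∂μ :=
        lintegral_finsetSum' _ fun j _ => ((hm j).smul ((ha j n).sub (hf j))).enorm
    _ ≤ ∑ j, C j * ∫⁻ x, ‖a j n x - f j x‖ₑ ∂μ :=
        Finset.sum_le_sum fun j _ => lintegral_enorm_smul_le (hC j)

end Limits

section Calculus

variable {G F : Type*} [NormedAddCommGroup G] [MeasurableSpace G] [NormedAddCommGroup F]
  {μ : Measure G} {W : Set G}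

lemma locallyIntegrableOn_of_ae_bounded [OpensMeasurableSpace G] [IsLocallyFiniteMeasure μ]
    {f : G → F} {C : ℝ} (hm : AEStronglyMeasurable f (μ.restrict W))
    (hf : ∀ᵐ x ∂μ.restrict W, ‖f x‖ ≤ C) : LocallyIntegrableOn f W μ :=
  locallyIntegrableOn_of_locallyIntegrable_restrict
    ((memLp_top_of_bound hm C hf).locallyIntegrable le_top)

variable [NormedSpace ℝ G] [NormedSpace ℝ F] {v : G}

/- Testing against `φ` only sees the compact set `tsupport φ`, on which the approximants converge
in `L¹`. -/
theorem IsWeakDirDeriv.of_approx [BorelSpace G] {f g : G → F} (hf : LocallyIntegrableOn f W μ)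
    (hg : LocallyIntegrableOn g W μ)
    (h : ∀ K, IsCompact K → K ⊆ W → ∃ a b : ℕ → G → F, (∀ n, IsWeakDirDeriv μ W v (a n) (b n)) ∧
      Tendsto (fun n => ∫⁻ x in K, ‖a n x - f x‖ₑ ∂μ) atTop (𝓝 0) ∧
      Tendsto (fun n => ∫⁻ x in K, ‖b n x - g x‖ₑ ∂μ) atTop (𝓝 0)) :
    IsWeakDirDeriv μ W v f g := by
  refine .of_setIntegral_tsupport_eq hf hg fun φ hφ hc hs => ?_
  obtain ⟨a, b, hab, ha, hb⟩ := h _ hc hs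
  have tendsto_integral {m : G → ℝ} (hm : Continuous m) (hmc : HasCompactSupport m)
      {a : ℕ → G → F} {f : G → F} (ha : ∀ n, LocallyIntegrableOn (a n) W μ)
      (hf : LocallyIntegrableOn f W μ)
      (hlim : Tendsto (fun n => ∫⁻ x in tsupport φ, ‖a n x - f x‖ₑ ∂μ) atTop (𝓝 0)) :
      Tendsto (fun n => ∫ x in tsupport φ, m x • a n x ∂μ) atTop
        (𝓝 (∫ x in tsupport φ, m x • f x ∂μ)) := by
    obtain ⟨C, hC⟩ := hmc.exists_bound_of_continuous hm
    exact tendsto_integral_smul_of_L1 (C := C.toNNReal) hm.aestronglyMeasurable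
      (.of_forall fun x => (hC x).trans (Real.le_coe_toNNReal C))
      (fun n => (ha n).integrableOn_compact_subset hs hc)
      (hf.integrableOn_compact_subset hs hc).aestronglyMeasurable hlim
  have lim_left := tendsto_integral
    ((hφ.continuous_fderiv (by simp)).clm_apply continuous_const) (hc.fderiv_apply ℝ v)
    (fun n => (hab n).locallyIntegrableOn) hf ha
  have lim_right := (tendsto_integral hφ.continuous hc
    (fun n => (hab n).locallyIntegrableOn_deriv) hg hb).neg
  exact tendsto_nhds_unique lim_left
    (lim_right.congr fun n => ((hab n).setIntegral_eq hφ hc subset_rfl hs).symm)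

variable [FiniteDimensional ℝ G]

lemma locallyIntegrableOn_smul_of_ae_bounded {h : G → ℝ} {f : G → F} {C : ℝ} (hW : IsOpen W)
    (hm : AEStronglyMeasurable h (μ.restrict W)) (hh : ∀ᵐ x ∂μ.restrict W, ‖h x‖ ≤ C)
    (hf : LocallyIntegrableOn f W μ) : LocallyIntegrableOn (fun z => h z • f z) W μ := by
  rw [locallyIntegrableOn_iff hW.isLocallyClosed] at hf ⊢
  exact fun k hkW hk => (hf k hkW hk).bdd_smul C
    (hm.mono_measure (Measure.restrict_mono hkW le_rfl))
    (ae_restrict_of_ae_restrict_of_subset hkW hh)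

variable [BorelSpace G]

lemma IsWeakDirDeriv.of_contDiff [μ.IsAddHaarMeasure] {u : G → F} (hu : ContDiff ℝ 1 u) :
    IsWeakDirDeriv μ W v u fun z => fderiv ℝ u z v := by
  have hu' : Continuous fun z => fderiv ℝ u z v :=
    (hu.continuous_fderiv (by simp)).clm_apply continuous_const
  refine ⟨hu.continuous.locallyIntegrable.locallyIntegrableOn W,
    hu'.locallyIntegrable.locallyIntegrableOn W, fun φ hφ hc hs => ?_⟩
  have hφ' : Continuous fun z => fderiv ℝ φ z v :=
    (hφ.continuous_fderiv (by simp)).clm_apply continuous_const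
  have support_fderiv := subset_closure.trans (tsupport_fderiv_apply_subset (f := φ) ℝ v)
  have by_parts := integral_smul_fderiv_eq_neg_fderiv_smul_of_integrable (μ := μ) (v := v)
    ((hφ'.smul hu.continuous).integrable_of_hasCompactSupport (hc.fderiv_apply ℝ v).smul_right)
    ((hφ.continuous.smul hu').integrable_of_hasCompactSupport hc.smul_right)
    ((hφ.continuous.smul hu.continuous).integrable_of_hasCompactSupport hc.smul_right)
    (fun z _ => hφ.differentiable (by simp) z) (fun z _ => hu.differentiable (by simp) z)
  rw [setIntegral_smul_eq_of_support_subset (support_fderiv.trans hs) (subset_univ _),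
    setIntegral_smul_eq_of_support_subset ((subset_tsupport φ).trans hs) (subset_univ _),
    setIntegral_univ, setIntegral_univ, by_parts, neg_neg]

lemma IsWeakDirDeriv.contDiff_smul {s : G → ℝ} {f f' : G → F} (hW : IsOpen W)
    (hs : ContDiff ℝ ∞ s) (hf : IsWeakDirDeriv μ W v f f') :
    IsWeakDirDeriv μ W v (fun z => s z • f z) (fun z => s z • f' z + fderiv ℝ s z v • f z) := by
  have hs' : Continuous fun z => fderiv ℝ s z v :=
    (hs.continuous_fderiv (by simp)).clm_apply continuous_const
  have smul_locallyIntegrable {m : G → ℝ} {w : G → F} (hm : Continuous m)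
      (hw : LocallyIntegrableOn w W μ) : LocallyIntegrableOn (fun z => m z • w z) W μ :=
    hw.continuousOn_smul hW.isLocallyClosed hm.continuousOn
  have hsf := smul_locallyIntegrable hs.continuous hf.locallyIntegrableOn
  have hsf' := smul_locallyIntegrable hs.continuous hf.locallyIntegrableOn_deriv
  have hs'f := smul_locallyIntegrable hs' hf.locallyIntegrableOn
  refine .of_setIntegral_tsupport_eq hsf (hsf'.add hs'f) fun φ hφ hc hφW => ?_
  have integrable {m : G → ℝ} {w : G → F} (hm : Continuous m) (hw : LocallyIntegrableOn w W μ) :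
      IntegrableOn (fun z => m z • w z) (tsupport φ) μ :=
    (hw.integrableOn_compact_subset hφW hc).continuousOn_smul hm.continuousOn hc
  have leibniz (z : G) : fderiv ℝ (fun z => φ z * s z) z v =
      fderiv ℝ φ z v * s z + φ z * fderiv ℝ s z v := by
    rw [fderiv_fun_mul (hφ.differentiable (by simp) z) (hs.differentiable (by simp) z)]
    simp; ring
  have test_mul := hf.setIntegral_eq (hφ.mul hs) hc.mul_right
    (K := tsupport φ) (tsupport_mul_subset_left (f := φ)) hφW
  simp only [leibniz, add_smul, mul_smul] at test_mul
  have hφ' : Continuous fun z => fderiv ℝ φ z v :=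
    (hφ.continuous_fderiv (by simp)).clm_apply continuous_const
  simp only [smul_add]
  rw [integral_add (integrable hφ' hsf) (integrable hφ.continuous hs'f)] at test_mul
  rw [integral_add (integrable hφ.continuous hsf') (integrable hφ.continuous hs'f), neg_add,
    ← test_mul, add_neg_cancel_right]

variable [μ.IsAddHaarMeasure]

theorem IsWeakDirDeriv.smul_of_ae_bounded {h h' : G → ℝ} {f f' : G → F} (hW : IsOpen W)
    (hh : IsWeakDirDeriv μ W v h h') (hf : IsWeakDirDeriv μ W v f f') {B B' : ℝ≥0}
    (hB : ∀ᵐ x ∂μ.restrict W, ‖h x‖ ≤ B) (hB' : ∀ᵐ x ∂μ.restrict W, ‖h' x‖ ≤ B') :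
    IsWeakDirDeriv μ W v (fun z => h z • f z) (fun z => h z • f' z + h' z • f z) := by
  have hhm := hh.locallyIntegrableOn.aestronglyMeasurable
  refine .of_approx (locallyIntegrableOn_smul_of_ae_bounded hW hhm hB hf.locallyIntegrableOn)
    ((locallyIntegrableOn_smul_of_ae_bounded hW hhm hB hf.locallyIntegrableOn_deriv).add
      (locallyIntegrableOn_smul_of_ae_bounded hW hh.locallyIntegrableOn_deriv.aestronglyMeasurable
        hB' hf.locallyIntegrableOn)) fun K hK hKW => ?_
  obtain ⟨s, hs, hsB, hsB', hlim, hlim'⟩ :=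
    hh.exists_contDiff_approx_of_ae_bounded hW hK hKW hB hB'
  have hs' (n : ℕ) : Continuous fun z => fderiv ℝ (s n) z v :=
    ((hs n).continuous_fderiv (by simp)).clm_apply continuous_const
  have hfK := hf.locallyIntegrableOn.integrableOn_compact_subset hKW hK
  have hfK' := hf.locallyIntegrableOn_deriv.integrableOn_compact_subset hKW hK
  refine ⟨_, _, fun n => hf.contDiff_smul hW (hs n),
    tendsto_lintegral_enorm_sub_of_dominated (bound := fun x => B * ‖f x‖) (fun n => ?_)
      (hfK.norm.const_mul _) (fun n => .of_forall fun x => ?_) ?_,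
    tendsto_lintegral_enorm_sub_of_dominated (bound := fun x => B * ‖f' x‖ + B' * ‖f x‖)
      (fun n => ?_) ((hfK'.norm.const_mul _).add (hfK.norm.const_mul _)) (fun n => ?_) ?_⟩
  · exact (hs n).continuous.aestronglyMeasurable.smul hfK.aestronglyMeasurable
  · exact (norm_smul_le _ _).trans (by gcongr; exact hsB n x)
  · filter_upwards [hlim] with x hx using hx.smul_const _
  · exact ((hs n).continuous.aestronglyMeasurable.smul hfK'.aestronglyMeasurable).add
      ((hs' n).aestronglyMeasurable.smul hfK.aestronglyMeasurable)
  · filter_upwards [ae_restrict_mem hK.measurableSet] with x hx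
    refine (norm_add_le _ _).trans (add_le_add ?_ ?_)
    · exact (norm_smul_le _ _).trans (by gcongr; exact hsB n x)
    · exact (norm_smul_le _ _).trans (by gcongr; exact hsB' n x hx)
  · filter_upwards [hlim, hlim'] with x hx hx' using (hx.smul_const _).add (hx'.smul_const _)

lemma exists_bound_fderiv_of_contDiff {H : Type*} [NormedAddCommGroup H] [NormedSpace ℝ H]
    [FiniteDimensional ℝ H] {u : H → F} (hu : ContDiff ℝ 1 u) (B B' : ℝ≥0) :
    ∃ A : ℝ, (∀ y, ‖y‖ ≤ B → ‖u y‖ ≤ A) ∧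
      ∀ y w, ‖y‖ ≤ B → ‖w‖ ≤ B' → ‖fderiv ℝ u y w‖ ≤ A := by
  have : ProperSpace H := .of_locallyCompactSpace ℝ
  obtain ⟨A, hA⟩ := (isCompact_closedBall (0 : H) B).exists_bound_of_continuousOn
    hu.continuous.continuousOn
  obtain ⟨A', hA'⟩ := (isCompact_closedBall (0 : H) B).exists_bound_of_continuousOn
    (hu.continuous_fderiv (by simp)).continuousOn
  simp only [mem_closedBall_zero_iff] at hA hA'
  refine ⟨max A (A' * B'), fun y hy => (hA y hy).trans (le_max_left _ _), fun y w hy hw => ?_⟩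
  refine ((ContinuousLinearMap.le_of_opNorm_le _ (hA' y hy) w).trans ?_).trans (le_max_right _ _)
  gcongr
  exact (norm_nonneg _).trans (hA' y hy)

theorem IsWeakDirDeriv.contDiff_comp {H : Type*} [NormedAddCommGroup H] [NormedSpace ℝ H]
    [FiniteDimensional ℝ H] {Φ Φ' : G → H} {u : H → F} (hW : IsOpen W)
    (hu : ContDiff ℝ 1 u) (h : IsWeakDirDeriv μ W v Φ Φ') {B B' : ℝ≥0}
    (hB : ∀ᵐ x ∂μ.restrict W, ‖Φ x‖ ≤ B) (hB' : ∀ᵐ x ∂μ.restrict W, ‖Φ' x‖ ≤ B') :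
    IsWeakDirDeriv μ W v (fun z => u (Φ z)) (fun z => fderiv ℝ u (Φ z) (Φ' z)) := by
  obtain ⟨A, hA, hA'⟩ := exists_bound_fderiv_of_contDiff hu B B'
  have continuous_eval : Continuous fun p : H × H => fderiv ℝ u p.1 p.2 :=
    ((hu.continuous_fderiv (by simp)).comp continuous_fst).clm_apply continuous_snd
  have hΦm := h.locallyIntegrableOn.aestronglyMeasurable
  refine .of_approx
    (locallyIntegrableOn_of_ae_bounded (hu.continuous.comp_aestronglyMeasurable hΦm)
      (hB.mono fun x => hA _))
    (locallyIntegrableOn_of_ae_bounded (continuous_eval.comp_aestronglyMeasurable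
      (hΦm.prodMk h.locallyIntegrableOn_deriv.aestronglyMeasurable))
      (by filter_upwards [hB, hB'] with x hx hx' using hA' _ _ hx hx')) fun K hK hKW => ?_
  have : IsFiniteMeasure (μ.restrict K) := isFiniteMeasure_restrict.2 hK.measure_ne_top
  obtain ⟨s, hs, hsB, hsB', hlim, hlim'⟩ :=
    h.exists_contDiff_approx_of_ae_bounded hW hK hKW hB hB'
  have hs' (n : ℕ) : Continuous fun z => fderiv ℝ (s n) z v :=
    ((hs n).continuous_fderiv (by simp)).clm_apply continuous_const
  have chain_rule (n : ℕ) (z : G) :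
      fderiv ℝ (u ∘ s n) z v = fderiv ℝ u (s n z) (fderiv ℝ (s n) z v) := by
    rw [fderiv_comp z (hu.differentiable (by simp) _) ((hs n).differentiable (by simp) z)]
    rfl
  have smooth (n : ℕ) : IsWeakDirDeriv μ W v (u ∘ s n)
      fun z => fderiv ℝ u (s n z) (fderiv ℝ (s n) z v) := by
    simpa only [chain_rule] using IsWeakDirDeriv.of_contDiff (μ := μ) (W := W) (v := v)
      (hu.comp ((hs n).of_le (by simp)))
  refine ⟨_, _, smooth, tendsto_lintegral_enorm_sub_of_dominated (fun n => ?_)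
      (integrable_const A) (fun n => .of_forall fun x => hA _ (hsB n x)) ?_,
    tendsto_lintegral_enorm_sub_of_dominated (fun n => ?_) (integrable_const A) (fun n => ?_) ?_⟩
  · exact (hu.continuous.comp (hs n).continuous).aestronglyMeasurable
  · filter_upwards [hlim] with x hx using (hu.continuous.tendsto _).comp hx
  · exact (continuous_eval.comp ((hs n).continuous.prodMk (hs' n))).aestronglyMeasurable
  · filter_upwards [ae_restrict_mem hK.measurableSet] with x hx
      using hA' _ _ (hsB n x) (hsB' n x hx)
  · filter_upwards [hlim, hlim'] with x hx hx'
      using (continuous_eval.tendsto (Φ x, Φ' x)).comp (hx.prodMk_nhds hx')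

end Calculus

section PullbackMaps

/-- `Φ` maps `W` continuously into `U` and distorts measure by at most the factor `c`: the part of
`W` mapped into a set is at most `c` times as large as that set. -/
structure IsPullbackMap {X Y : Type*} [TopologicalSpace X] [TopologicalSpace Y] [MeasurableSpace X]
    [MeasurableSpace Y] (μ : Measure X) (ν : Measure Y) (c : ℝ≥0) (W : Set X) (U : Set Y)
    (Φ : X → Y) : Prop where
  continuousOn : ContinuousOn Φ W
  mapsTo : MapsTo Φ W U
  map_le : (μ.restrict W).map Φ ≤ c • ν.restrict U

variable {X Y F : Type*} [TopologicalSpace X] [TopologicalSpace Y] [MeasurableSpace X]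
  [MeasurableSpace Y] [NormedAddCommGroup F] {μ : Measure X} {ν : Measure Y} {c : ℝ≥0}
  {K W : Set X} {U : Set Y} {Φ : X → Y}

lemma IsPullbackMap.absolutelyContinuous (h : IsPullbackMap μ ν c W U Φ) :
    (μ.restrict W).map Φ ≪ ν.restrict U :=
  (Measure.absolutelyContinuous_of_le h.map_le).trans Measure.smul_absolutelyContinuous

variable [OpensMeasurableSpace X] [BorelSpace Y]

lemma IsPullbackMap.restrict [T2Space Y] (h : IsPullbackMap μ ν c W U Φ) (hW : MeasurableSet W)
    (hK : IsCompact K) (hKm : MeasurableSet K) (hKW : K ⊆ W) :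
    IsPullbackMap μ ν c K (Φ '' K) Φ := by
  have hΦK : MeasurableSet (Φ '' K) :=
    (hK.image_of_continuousOn (h.continuousOn.mono hKW)).measurableSet
  have aemeasurable := h.continuousOn.aemeasurable hW (μ := μ)
  have restrict_le : μ.restrict K ≤ μ.restrict W := Measure.restrict_mono hKW le_rfl
  refine ⟨h.continuousOn.mono hKW, mapsTo_image _ _, ?_⟩
  calc (μ.restrict K).map Φ
      = ((μ.restrict K).map Φ).restrict (Φ '' K) := by
        refine (Measure.restrict_eq_self_of_ae_mem ?_).symm
        exact (ae_map_iff (aemeasurable.mono_measure restrict_le) hΦK).2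
          ((ae_restrict_mem hKm).mono fun z => mem_image_of_mem Φ)
    _ ≤ ((μ.restrict W).map Φ).restrict (Φ '' K) :=
        Measure.restrict_mono le_rfl (Measure.map_mono_of_aemeasurable restrict_le aemeasurable)
    _ ≤ (c • ν.restrict U).restrict (Φ '' K) := Measure.restrict_mono le_rfl h.map_le
    _ = c • ν.restrict (Φ '' K) := by
        rw [Measure.restrict_smul, Measure.restrict_restrict hΦK,
          inter_eq_left.2 (h.mapsTo.mono_left hKW).image_subset]

lemma IsPullbackMap.lintegral_comp_le (h : IsPullbackMap μ ν c W U Φ) (hW : MeasurableSet W)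
    {w : Y → ℝ≥0∞} (hw : AEMeasurable w (ν.restrict U)) :
    ∫⁻ z in W, w (Φ z) ∂μ ≤ c * ∫⁻ y in U, w y ∂ν :=
  calc ∫⁻ z in W, w (Φ z) ∂μ
      = ∫⁻ y, w y ∂((μ.restrict W).map Φ) :=
        (lintegral_map' (hw.mono_ac h.absolutelyContinuous) (h.continuousOn.aemeasurable hW)).symm
    _ ≤ ∫⁻ y, w y ∂(c • ν.restrict U) := lintegral_mono' h.map_le le_rfl
    _ = c * ∫⁻ y in U, w y ∂ν := lintegral_smul_measure _ _

variable {w : Y → F}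

lemma IsPullbackMap.aestronglyMeasurable_comp (h : IsPullbackMap μ ν c W U Φ)
    (hW : MeasurableSet W) (hw : AEStronglyMeasurable w (ν.restrict U)) :
    AEStronglyMeasurable (fun z => w (Φ z)) (μ.restrict W) :=
  (hw.mono_ac h.absolutelyContinuous).comp_aemeasurable (h.continuousOn.aemeasurable hW)

lemma IsPullbackMap.eLpNorm_comp_le (h : IsPullbackMap μ ν c W U Φ) (hW : MeasurableSet W)
    (hw : AEStronglyMeasurable w (ν.restrict U)) (r : ℝ≥0∞) :
    eLpNorm (fun z => w (Φ z)) r (μ.restrict W) ≤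
      (c : ℝ≥0∞) ^ (1 / r).toReal * eLpNorm w r (ν.restrict U) := by
  rw [← Function.comp_def, ← eLpNorm_map_measure (hw.mono_ac h.absolutelyContinuous)
    (h.continuousOn.aemeasurable hW)]
  exact eLpNorm_le_of_measure_le_smul h.map_le

lemma IsPullbackMap.integrableOn_comp (h : IsPullbackMap μ ν c W U Φ) (hW : MeasurableSet W)
    (hw : IntegrableOn w U ν) : IntegrableOn (fun z => w (Φ z)) W μ :=
  ⟨h.aestronglyMeasurable_comp hW hw.aestronglyMeasurable,
    (h.lintegral_comp_le hW hw.aestronglyMeasurable.enorm).trans_lt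
      (ENNReal.mul_lt_top ENNReal.coe_lt_top hw.hasFiniteIntegral)⟩

lemma IsPullbackMap.locallyIntegrableOn_comp [LocallyCompactSpace X] [T2Space X] [T2Space Y]
    (h : IsPullbackMap μ ν c W U Φ) (hW : IsOpen W) (hw : LocallyIntegrableOn w U ν) :
    LocallyIntegrableOn (fun z => w (Φ z)) W μ :=
  (locallyIntegrableOn_iff hW.isLocallyClosed).2 fun _ hKW hK =>
    (h.restrict hW.measurableSet hK hK.measurableSet hKW).integrableOn_comp hK.measurableSet
      (hw.integrableOn_compact_subset (h.mapsTo.mono_left hKW).image_subset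
        (hK.image_of_continuousOn (h.continuousOn.mono hKW)))

lemma IsPullbackMap.tendsto_lintegral_enorm_comp_sub (h : IsPullbackMap μ ν c W U Φ)
    (hW : MeasurableSet W) {a : ℕ → Y → F} (ha : ∀ n, AEStronglyMeasurable (a n) (ν.restrict U))
    (hw : AEStronglyMeasurable w (ν.restrict U))
    (hlim : Tendsto (fun n => ∫⁻ y in U, ‖a n y - w y‖ₑ ∂ν) atTop (𝓝 0)) :
    Tendsto (fun n => ∫⁻ z in W, ‖a n (Φ z) - w (Φ z)‖ₑ ∂μ) atTop (𝓝 0) := by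
  have upper : Tendsto (fun n => c * ∫⁻ y in U, ‖a n y - w y‖ₑ ∂ν) atTop (𝓝 0) := by
    simpa using ENNReal.Tendsto.const_mul hlim (.inr (ENNReal.coe_ne_top (r := c)))
  exact tendsto_of_tendsto_of_tendsto_of_le_of_le tendsto_const_nhds upper (fun _ => zero_le)
    fun n => h.lintegral_comp_le hW ((ha n).sub hw).enorm

end PullbackMaps

section ChainRule

variable {G H F : Type*} [NormedAddCommGroup G] [NormedSpace ℝ G] [FiniteDimensional ℝ G]
  [MeasurableSpace G] [BorelSpace G] [NormedAddCommGroup H] [NormedSpace ℝ H]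
  [FiniteDimensional ℝ H] [MeasurableSpace H] [BorelSpace H] [NormedAddCommGroup F]
  [NormedSpace ℝ F] [CompleteSpace F] {μ : Measure G} {ν : Measure H} [μ.IsAddHaarMeasure]
  [ν.IsAddHaarMeasure] {c : ℝ≥0} {W : Set G} {U : Set H}

theorem IsWeakDirDeriv.comp {ι : Type*} [Fintype ι] {e : ι → H} {ℓ : ι → H →L[ℝ] ℝ}
    (hℓ : ∀ y, ∑ j, ℓ j y • e j = y) {Φ Φ' : G → H} {v : G} {u : H → F} {w : ι → H → F}
    (hW : IsOpen W) (hU : IsOpen U) (hΦ : IsPullbackMap μ ν c W U Φ)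
    (huU : LocallyIntegrableOn u U ν) (hu : ∀ j, IsWeakDirDeriv ν U (e j) u (w j))
    (h : IsWeakDirDeriv μ W v Φ Φ') {B B' : ℝ≥0} (hB : ∀ᵐ x ∂μ.restrict W, ‖Φ x‖ ≤ B)
    (hB' : ∀ᵐ x ∂μ.restrict W, ‖Φ' x‖ ≤ B') :
    IsWeakDirDeriv μ W v (fun z => u (Φ z)) (fun z => ∑ j, ℓ j (Φ' z) • w j (Φ z)) := by
  have coord_aestronglyMeasurable (j : ι) :
      AEStronglyMeasurable (fun z => ℓ j (Φ' z)) (μ.restrict W) :=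
    (ℓ j).continuous.comp_aestronglyMeasurable h.locallyIntegrableOn_deriv.aestronglyMeasurable
  have coord_le (j : ι) : ∀ᵐ z ∂μ.restrict W, ‖ℓ j (Φ' z)‖ ≤ (‖ℓ j‖₊ * B' : ℝ≥0) :=
    hB'.mono fun z hz => (ℓ j).le_opNorm_of_le hz
  have smul_locallyIntegrableOn (j : ι) :=
    locallyIntegrableOn_smul_of_ae_bounded hW (coord_aestronglyMeasurable j) (coord_le j)
      (hΦ.locallyIntegrableOn_comp hW (hu j).locallyIntegrableOn_deriv)
  refine .of_approx (hΦ.locallyIntegrableOn_comp hW huU)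
    ((locallyIntegrableOn_iff hW.isLocallyClosed).2 fun k hkW hk => integrable_finsetSum _
      fun j _ => (smul_locallyIntegrableOn j).integrableOn_compact_subset hkW hk) fun K hK hKW => ?_
  have hΦKU := (hΦ.mapsTo.mono_left hKW).image_subset
  have hΦK := hΦ.restrict hW.measurableSet hK hK.measurableSet hKW
  obtain ⟨s, hs, hlim, hlim'⟩ := exists_contDiff_approx_lintegral huU hu hU
    (hK.image_of_continuousOn hΦK.continuousOn) hΦKU
  have deriv_aestronglyMeasurable (n : ℕ) (j : ι) :
      AEStronglyMeasurable (fun y => fderiv ℝ (s n) y (e j)) (ν.restrict (Φ '' K)) :=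
    (((hs n).continuous_fderiv (by simp)).clm_apply continuous_const).aestronglyMeasurable
  have locallyIntegrableOn_aestronglyMeasurable {q : H → F} (hq : LocallyIntegrableOn q U ν) :
      AEStronglyMeasurable q (ν.restrict (Φ '' K)) := (hq.mono_set hΦKU).aestronglyMeasurable
  have expand (n : ℕ) (z : G) : fderiv ℝ (s n) (Φ z) (Φ' z) =
      ∑ j, ℓ j (Φ' z) • fderiv ℝ (s n) (Φ z) (e j) := by
    conv_lhs => rw [← hℓ (Φ' z), map_sum]
    simp only [map_smul]
  refine ⟨_, _, fun n => h.contDiff_comp hW ((hs n).of_le (by simp)) hB hB',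
    hΦK.tendsto_lintegral_enorm_comp_sub hK.measurableSet
      (fun n => (hs n).continuous.aestronglyMeasurable)
      (locallyIntegrableOn_aestronglyMeasurable huU) hlim, ?_⟩
  simp only [expand]
  have hw (j : ι) := locallyIntegrableOn_aestronglyMeasurable (hu j).locallyIntegrableOn_deriv
  exact tendsto_lintegral_enorm_sum_smul_sub
    (fun j => (coord_aestronglyMeasurable j).mono_measure (Measure.restrict_mono hKW le_rfl))
    (fun j => ae_restrict_of_ae_restrict_of_subset hKW (coord_le j))
    (fun j n => hΦK.aestronglyMeasurable_comp hK.measurableSet (deriv_aestronglyMeasurable n j))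
    (fun j => hΦK.aestronglyMeasurable_comp hK.measurableSet (hw j))
    fun j => hΦK.tendsto_lintegral_enorm_comp_sub hK.measurableSet
      (deriv_aestronglyMeasurable · j) (hw j) (hlim' j)

end ChainRule

section Deformation

lemma measure_le_of_antilipschitz {V : Type*} [NormedAddCommGroup V] [NormedSpace ℝ V]
    [FiniteDimensional ℝ V] [MeasurableSpace V] [BorelSpace V] (μ : Measure V) [μ.IsAddHaarMeasure]
    {L : ℝ≥0} {f : V → V} {A : Set V} (hf : AntilipschitzWith L (A.domRestrict f)) :
    μ A ≤ (L : ℝ≥0∞) ^ Module.finrank ℝ V * μ (f '' A) := by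
  have hausdorff_le := hf.le_hausdorffMeasure_image (d := Module.finrank ℝ V) (by positivity) univ
  rw [← isometry_subtype_coe.hausdorffMeasure_image (.inl (by positivity)), image_univ, image_univ,
    range_domRestrict, Subtype.range_coe, ENNReal.rpow_natCast] at hausdorff_le
  rw [Measure.isAddLeftInvariant_eq_smul μ (Measure.hausdorffMeasure (Module.finrank ℝ V)),
    Measure.smul_apply, Measure.smul_apply, mul_smul_comm]
  gcongr

instance isAddHaarMeasure_volume_ST (d : ℕ) : (volume : Measure (ST d)).IsAddHaarMeasure :=
  inferInstanceAs ((volume : Measure (EuclideanSpace ℝ (Fin d))).prod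
    (volume : Measure ℝ)).IsAddHaarMeasure

variable {d : ℕ} {L : ℝ≥0} {E : Set (ST d)} {Ψ : ST d → EuclideanSpace ℝ (Fin d)}

lemma IsDeformation.isPullbackMap (h : IsDeformation L E Ψ) :
    IsPullbackMap volume volume (L ^ d) E (spaceTimeMap Ψ '' E) (spaceTimeMap Ψ) := by
  refine ⟨h.continuousOn, mapsTo_image _ _, Measure.le_iff.2 fun s hs => ?_⟩
  have hE := h.isOpen_domain.measurableSet
  have measurableSet_preimage : MeasurableSet (spaceTimeMap Ψ ⁻¹' s ∩ E) := by
    simpa only [domRestrict_eq, preimage_comp, Subtype.image_preimage_coe, inter_comm] using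
      hE.subtype_image
        ((continuousOn_iff_continuous_domRestrict.1 h.continuousOn).measurable hs)
  rw [Measure.map_apply_of_aemeasurable (h.continuousOn.aemeasurable hE) hs,
    Measure.restrict_apply' hE, Measure.smul_apply, Measure.restrict_apply hs]
  change (volume.prod volume) _ ≤ _ • (volume.prod volume) _
  rw [Measure.prod_apply_symm measurableSet_preimage,
    Measure.prod_apply_symm (hs.inter h.isOpen_image.measurableSet), ENNReal.smul_def,
    smul_eq_mul, ← lintegral_const_mul' _ _ ENNReal.coe_ne_top]
  refine lintegral_mono fun t => ?_
  have slice_antilipschitz : AntilipschitzWith L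
      (((fun x => (x, t)) ⁻¹' (spaceTimeMap Ψ ⁻¹' s ∩ E)).domRestrict fun x => Ψ (x, t)) :=
    .of_le_mul_dist fun x y => by
      simpa only [Subtype.dist_eq, dist_eq_norm, domRestrict_apply] using
        h.antilipschitz t x y x.2.2 y.2.2
  refine (measure_le_of_antilipschitz volume slice_antilipschitz).trans ?_
  rw [finrank_euclideanSpace_fin, ENNReal.coe_pow]
  gcongr
  rintro _ ⟨x, hx, rfl⟩
  exact ⟨hx.1, mem_image_of_mem (spaceTimeMap Ψ) hx.2⟩

end Deformation

section MultiIndices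

variable {d : ℕ}

/-- The index of a coordinate direction of space-time: `none` stands for time, `some i` for the
`i`-th space coordinate. -/
abbrev Dir (d : ℕ) : Type := Option (Fin d)

/-- The order in the coordinate direction `e` of the differential operator with multi-index `a`. -/
def dirDegree (a : MIdx d) (e : Dir d) : ℕ := e.elim a.2 a.1

/-- The multi-index of the first-order derivative in a coordinate direction. -/
def dirIdx : Dir d → MIdx d
  | none => idxT d
  | some i => idxX i

/-- The coordinate vectors of space-time. -/
noncomputable def dirVec : Dir d → ST d
  | none => (0, 1)
  | some i => (EuclideanSpace.single i 1, 0)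

/-- The coordinate functionals of space-time. -/
noncomputable def dirCoord : Dir d → ST d →L[ℝ] ℝ
  | none => .snd ℝ _ _
  | some i => (EuclideanSpace.proj i).comp (.fst ℝ _ _)

lemma sum_dirCoord_smul_dirVec (y : ST d) : ∑ j, dirCoord j y • dirVec j = y := by
  rw [Fintype.sum_option]
  refine Prod.ext ?_ ?_
  · ext i
    simp [dirCoord, dirVec, Prod.fst_sum, Pi.single_apply]
  · simp [dirCoord, dirVec, Prod.snd_sum]

lemma dirDegree_add (a b : MIdx d) : dirDegree (a + b) = dirDegree a + dirDegree b := by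
  ext (_ | i) <;> rfl

lemma dirDegree_dirIdx (e : Dir d) : dirDegree (dirIdx e) = Pi.single e 1 := by
  ext e'
  cases e <;> cases e' <;> simp [dirDegree, dirIdx, idxT, idxX, Pi.single_apply]

lemma dirDegree_injective : Function.Injective (dirDegree : MIdx d → Dir d → ℕ) := fun _ _ h =>
  Prod.ext (funext fun i => congrFun h (some i)) (congrFun h none)

lemma totalOrder_eq_sum_dirDegree (a : MIdx d) : totalOrder a = ∑ e, dirDegree a e := by
  rw [Fintype.sum_option, add_comm]
  rfl

lemma totalOrder_add (a b : MIdx d) : totalOrder (a + b) = totalOrder a + totalOrder b := by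
  simp only [totalOrder_eq_sum_dirDegree, dirDegree_add, Pi.add_apply, Finset.sum_add_distrib]

lemma totalOrder_dirIdx (e : Dir d) : totalOrder (dirIdx e) = 1 := by
  rw [totalOrder_eq_sum_dirDegree, dirDegree_dirIdx, Finset.sum_pi_single' e 1]
  simp

lemma totalOrder_zero : totalOrder (0 : MIdx d) = 0 := by
  simpa using totalOrder_add (0 : MIdx d) 0

end MultiIndices

section ClassicalDerivatives

variable {d : ℕ} {φ : ST d → ℝ}

/-- The classical derivative in a coordinate direction. -/
noncomputable def partialDir (e : Dir d) (φ : ST d → ℝ) : ST d → ℝ :=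
  fun z => fderiv ℝ φ z (dirVec e)

lemma contDiff_partialDir (hφ : ContDiff ℝ ∞ φ) (e : Dir d) : ContDiff ℝ ∞ (partialDir e φ) :=
  (hφ.fderiv_right (m := ∞) (by simp)).clm_apply contDiff_const

lemma partialDir_comm (hφ : ContDiff ℝ ∞ φ) (e e' : Dir d) :
    partialDir e (partialDir e' φ) = partialDir e' (partialDir e φ) := by
  have differentiable : Differentiable ℝ (fderiv ℝ φ) :=
    (hφ.fderiv_right (m := ∞) (by simp)).differentiable (by simp)
  have second_fderiv (e e' : Dir d) (z : ST d) : partialDir e (partialDir e' φ) z =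
      fderiv ℝ (fderiv ℝ φ) z (dirVec e) (dirVec e') := by
    unfold partialDir
    rw [fderiv_clm_apply (differentiable z) (differentiableAt_const _)]
    simp
  have symmetric (z : ST d) : IsSymmSndFDerivAt ℝ φ z := hφ.contDiffAt.isSymmSndFDerivAt
    (by simpa using WithTop.coe_le_coe.2 (le_top : (2 : ℕ∞) ≤ ⊤))
  ext z
  rw [second_fderiv, second_fderiv, (symmetric z).eq]

/-- The composition of the operators `(∂/∂e)^(m e)` over the directions `e` in a list. -/
noncomputable def iterPartial (l : List (Dir d)) (m : Dir d → ℕ) (φ : ST d → ℝ) : ST d → ℝ :=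
  l.foldr (fun e f => (partialDir e)^[m e] f) φ

lemma iterPartial_cons (e : Dir d) (l : List (Dir d)) (m : Dir d → ℕ) (φ : ST d → ℝ) :
    iterPartial (e :: l) m φ = (partialDir e)^[m e] (iterPartial l m φ) := rfl

lemma iterPartial_induction {P : (ST d → ℝ) → Prop} (hP : ∀ e φ, P φ → P (partialDir e φ))
    (hφ : P φ) (l : List (Dir d)) (m : Dir d → ℕ) : P (iterPartial l m φ) := by
  induction l with
  | nil => exact hφ
  | cons e l ih => exact Function.Iterate.rec P ih (hP e) (m e)

lemma contDiff_iterPartial (hφ : ContDiff ℝ ∞ φ) (l : List (Dir d)) (m : Dir d → ℕ) :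
    ContDiff ℝ ∞ (iterPartial l m φ) :=
  iterPartial_induction (P := ContDiff ℝ ∞) (fun e _ h => contDiff_partialDir h e) hφ l m

lemma iterate_partialDir_partialDir (hφ : ContDiff ℝ ∞ φ) (e e' : Dir d) (n : ℕ) :
    (partialDir e)^[n] (partialDir e' φ) = partialDir e' ((partialDir e)^[n] φ) := by
  induction n generalizing φ with
  | zero => rfl
  | succ n ih =>
    rw [Function.iterate_succ_apply, partialDir_comm hφ, ih (contDiff_partialDir hφ e),
      ← Function.iterate_succ_apply]

lemma iterPartial_partialDir (hφ : ContDiff ℝ ∞ φ) (l : List (Dir d)) (m : Dir d → ℕ) (e : Dir d) :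
    iterPartial l m (partialDir e φ) = partialDir e (iterPartial l m φ) := by
  induction l with
  | nil => rfl
  | cons e' l ih =>
    rw [iterPartial_cons, ih, iterate_partialDir_partialDir (contDiff_iterPartial hφ l m),
      ← iterPartial_cons]

lemma iterPartial_iterate_partialDir (hφ : ContDiff ℝ ∞ φ) (l : List (Dir d)) (m : Dir d → ℕ)
    (e : Dir d) (n : ℕ) :
    iterPartial l m ((partialDir e)^[n] φ) = (partialDir e)^[n] (iterPartial l m φ) := by
  induction n generalizing φ with
  | zero => rfl
  | succ n ih =>
    rw [Function.iterate_succ_apply, ih (contDiff_partialDir hφ e), iterPartial_partialDir hφ,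
      ← Function.iterate_succ_apply]

lemma iterPartial_add (hφ : ContDiff ℝ ∞ φ) (l : List (Dir d)) (m m' : Dir d → ℕ) :
    iterPartial l (m + m') φ = iterPartial l m (iterPartial l m' φ) := by
  induction l with
  | nil => rfl
  | cons e l ih =>
    simp only [iterPartial_cons, ih, Pi.add_apply, Function.iterate_add_apply]
    rw [iterPartial_iterate_partialDir (contDiff_iterPartial hφ l m')]

lemma iterPartial_single (l : List (Dir d)) (e : Dir d) (φ : ST d → ℝ) :
    iterPartial l (Pi.single e 1) φ = (partialDir e)^[l.count e] φ := by
  induction l with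
  | nil => rfl
  | cons e' l ih =>
    rw [iterPartial_cons, ih]
    obtain rfl | h := eq_or_ne e' e
    · rw [Pi.single_eq_same, List.count_cons_self, Function.iterate_one,
        Function.iterate_succ_apply']
    · rw [Pi.single_eq_of_ne h, List.count_cons_of_ne h, Function.iterate_zero_apply]

lemma classicalDeriv_eq_iterPartial (a : MIdx d) (φ : ST d → ℝ) :
    classicalDeriv a φ = iterPartial ((List.finRange d).map some ++ [none]) (dirDegree a) φ := by
  rw [iterPartial, List.foldr_append, List.foldr_map]
  rfl

lemma contDiff_classicalDeriv (hφ : ContDiff ℝ ∞ φ) (a : MIdx d) :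
    ContDiff ℝ ∞ (classicalDeriv a φ) := by
  rw [classicalDeriv_eq_iterPartial]
  exact contDiff_iterPartial hφ _ _

lemma tsupport_classicalDeriv_subset (φ : ST d → ℝ) (a : MIdx d) :
    tsupport (classicalDeriv a φ) ⊆ tsupport φ := by
  rw [classicalDeriv_eq_iterPartial]
  exact iterPartial_induction (P := fun ψ => tsupport ψ ⊆ tsupport φ)
    (fun e _ h => (tsupport_fderiv_apply_subset ℝ (dirVec e)).trans h) subset_rfl _ _

lemma classicalDeriv_add (hφ : ContDiff ℝ ∞ φ) (a b : MIdx d) :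
    classicalDeriv (a + b) φ = classicalDeriv a (classicalDeriv b φ) := by
  simp only [classicalDeriv_eq_iterPartial, dirDegree_add, iterPartial_add hφ]

lemma classicalDeriv_dirIdx (e : Dir d) (φ : ST d → ℝ) :
    classicalDeriv (dirIdx e) φ = partialDir e φ := by
  rw [classicalDeriv_eq_iterPartial, dirDegree_dirIdx, iterPartial_single,
    List.count_eq_one_of_mem, Function.iterate_one]
  · simp [List.nodup_append, List.nodup_map_iff (Option.some_injective _), List.nodup_finRange]
  · cases e <;> simp

lemma classicalDeriv_zero (φ : ST d → ℝ) : classicalDeriv 0 φ = φ := by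
  rw [classicalDeriv_eq_iterPartial]
  induction (List.finRange d).map some ++ [none] with
  | nil => rfl
  | cons e l ih => cases e <;> exact ih

end ClassicalDerivatives

section WeakDerivatives

variable {d : ℕ} {F F' : Type*} [NormedAddCommGroup F] [NormedSpace ℝ F] [NormedAddCommGroup F']
  [NormedSpace ℝ F'] {W : Set (ST d)} {a b : MIdx d} {f f' g g' w : ST d → F}

lemma hasWeakDeriv_dirIdx_iff {e : Dir d} :
    HasWeakDeriv W (dirIdx e) f g ↔ IsWeakDirDeriv volume W (dirVec e) f g := by
  simp only [HasWeakDeriv, classicalDeriv_dirIdx, totalOrder_dirIdx, pow_one, neg_one_smul]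
  exact ⟨fun h => ⟨h.1, h.2.1, h.2.2⟩, fun h => ⟨h.1, h.2, h.3⟩⟩

lemma hasWeakDeriv_zero_self (hf : LocallyIntegrableOn f W) : HasWeakDeriv W 0 f f :=
  ⟨hf, hf, fun φ _ _ _ => by rw [classicalDeriv_zero, totalOrder_zero, pow_zero, one_smul]⟩

lemma HasWeakDeriv.integral_classicalDeriv_add (h : HasWeakDeriv W a f g) {φ : ST d → ℝ}
    (hφ : ContDiff ℝ ∞ φ) (hc : HasCompactSupport φ) (hs : tsupport φ ⊆ W) (b : MIdx d) :
    ∫ z in W, classicalDeriv (a + b) φ z • f z =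
      (-1 : ℝ) ^ totalOrder a • ∫ z in W, classicalDeriv b φ z • g z := by
  have tsupport_subset := tsupport_classicalDeriv_subset φ b
  rw [classicalDeriv_add hφ, h.2.2 _ (contDiff_classicalDeriv hφ b)
    (hc.of_isClosed_subset (isClosed_tsupport _) tsupport_subset) (tsupport_subset.trans hs)]

lemma HasWeakDeriv.trans (h : HasWeakDeriv W a f g) (h' : HasWeakDeriv W b g w) :
    HasWeakDeriv W (a + b) f w := by
  refine ⟨h.1, h'.2.1, fun φ hφ hc hs => ?_⟩
  rw [h.integral_classicalDeriv_add hφ hc hs, h'.2.2 φ hφ hc hs, totalOrder_add, pow_add, mul_smul]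

lemma HasWeakDeriv.of_add (h : HasWeakDeriv W a f g) (h' : HasWeakDeriv W (a + b) f w) :
    HasWeakDeriv W b g w := by
  refine ⟨h.2.1, h'.2.1, fun φ hφ hc hs => ?_⟩
  have test := h'.2.2 φ hφ hc hs
  rw [h.integral_classicalDeriv_add hφ hc hs, totalOrder_add, pow_add, mul_smul] at test
  exact smul_right_injective F (pow_ne_zero (totalOrder a) (neg_ne_zero.2 one_ne_zero)) test

lemma integrable_smul_of_hasCompactSupport {φ : ST d → ℝ} (hφ : Continuous φ)
    (hc : HasCompactSupport φ) (hs : tsupport φ ⊆ W) (hf : LocallyIntegrableOn f W) :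
    Integrable (fun z => φ z • f z) :=
  (integrableOn_iff_integrable_of_support_subset
    ((Function.support_smul_subset_left φ f).trans (subset_tsupport φ))).1
    ((hf.integrableOn_compact_subset hs hc).continuousOn_smul hφ.continuousOn hc)

lemma integrable_classicalDeriv_smul {φ : ST d → ℝ} (hφ : ContDiff ℝ ∞ φ)
    (hc : HasCompactSupport φ) (hs : tsupport φ ⊆ W) (hf : LocallyIntegrableOn f W) (a : MIdx d) :
    Integrable (fun z => classicalDeriv a φ z • f z) :=
  integrable_smul_of_hasCompactSupport (contDiff_classicalDeriv hφ a).continuous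
    (hc.of_isClosed_subset (isClosed_tsupport _) (tsupport_classicalDeriv_subset φ a))
    ((tsupport_classicalDeriv_subset φ a).trans hs) hf

lemma HasWeakDeriv.add (h : HasWeakDeriv W a f g) (h' : HasWeakDeriv W a f' g') :
    HasWeakDeriv W a (fun z => f z + f' z) (fun z => g z + g' z) := by
  refine ⟨h.1.add h'.1, h.2.1.add h'.2.1, fun φ hφ hc hs => ?_⟩
  simp only [smul_add]
  rw [integral_add (integrable_classicalDeriv_smul hφ hc hs h.1 a).integrableOn
      (integrable_classicalDeriv_smul hφ hc hs h'.1 a).integrableOn,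
    integral_add (integrable_smul_of_hasCompactSupport hφ.continuous hc hs h.2.1).integrableOn
      (integrable_smul_of_hasCompactSupport hφ.continuous hc hs h'.2.1).integrableOn,
    h.2.2 φ hφ hc hs, h'.2.2 φ hφ hc hs, smul_add]

variable [CompleteSpace F]

lemma HasWeakDeriv.ae_eq (hW : IsOpen W) (h : HasWeakDeriv W a f g) (h' : HasWeakDeriv W a f w) :
    g =ᵐ[volume.restrict W] w := by
  have integral_eq_zero (φ : ST d → ℝ) (hφ : ContDiff ℝ ∞ φ) (hc : HasCompactSupport φ)
      (hs : tsupport φ ⊆ W) : ∫ z, φ z • (g - w) z = 0 := by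
    have integral_eq := smul_right_injective F
      (pow_ne_zero (totalOrder a) (neg_ne_zero.2 one_ne_zero))
      ((h.2.2 φ hφ hc hs).symm.trans (h'.2.2 φ hφ hc hs))
    have support_subset := (subset_tsupport φ).trans hs
    rw [← setIntegral_univ, setIntegral_smul_eq_of_support_subset (subset_univ _) support_subset]
    simp only [Pi.sub_apply, smul_sub]
    rw [integral_sub
      (integrable_smul_of_hasCompactSupport hφ.continuous hc hs h.2.1).integrableOn
      (integrable_smul_of_hasCompactSupport hφ.continuous hc hs h'.2.1).integrableOn]
    exact sub_eq_zero.2 integral_eq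
  refine (ae_restrict_iff' hW.measurableSet).2 ?_
  filter_upwards [hW.ae_eq_zero_of_integral_contDiff_smul_eq_zero (h.2.1.sub h'.2.1)
    integral_eq_zero] with z hz hzW using sub_eq_zero.1 (hz hzW)

lemma HasWeakDeriv.clm_comp [CompleteSpace F'] (ℓ : F →L[ℝ] F') (h : HasWeakDeriv W a f g) :
    HasWeakDeriv W a (fun z => ℓ (f z)) (fun z => ℓ (g z)) := by
  refine ⟨ℓ.locallyIntegrableOn_comp h.1, ℓ.locallyIntegrableOn_comp h.2.1, fun φ hφ hc hs => ?_⟩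
  have test := congrArg ℓ (h.2.2 φ hφ hc hs)
  rw [map_smul, ← ℓ.integral_comp_comm (integrable_classicalDeriv_smul hφ hc hs h.1 a).integrableOn,
    ← ℓ.integral_comp_comm
      (integrable_smul_of_hasCompactSupport hφ.continuous hc hs h.2.1).integrableOn] at test
  simpa only [map_smul] using test

end WeakDerivatives

section SobolevBounds

variable {d d' : ℕ} {F F' : Type*} [NormedAddCommGroup F] [NormedAddCommGroup F'] {r : ℝ≥0∞}
  {W : Set (ST d)} {U : Set (ST d')} {B B' c : ℝ≥0} {k : ℕ} {f g : ST d → F}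

/-- `f` is measurable on `W` with `L^r(W)` norm at most `B`: membership in `L^r(W)` with a
quantitative bound. -/
structure LpBound (r : ℝ≥0∞) (W : Set (ST d)) (B : ℝ≥0) (f : ST d → F) : Prop where
  aestronglyMeasurable : AEStronglyMeasurable f (volume.restrict W)
  eLpNorm_le : eLpNorm f r (volume.restrict W) ≤ B

lemma LpBound.locallyIntegrableOn (hr : 1 ≤ r) (h : LpBound r W B f) : LocallyIntegrableOn f W :=
  locallyIntegrableOn_of_locallyIntegrable_restrict
    (MemLp.locallyIntegrable ⟨h.1, h.2.trans_lt ENNReal.coe_lt_top⟩ hr)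

lemma LpBound.ae_norm_le (h : LpBound ⊤ W B f) : ∀ᵐ z ∂volume.restrict W, ‖f z‖ ≤ B := by
  filter_upwards [ae_le_eLpNormEssSup (f := f) (μ := volume.restrict W)] with z hz
  have enorm_le : ‖f z‖ₑ ≤ B := hz.trans (eLpNorm_exponent_top.symm.trans_le h.eLpNorm_le)
  rwa [enorm_eq_nnnorm, ENNReal.coe_le_coe] at enorm_le

lemma LpBound.mono (hB : B ≤ B') (h : LpBound r W B f) : LpBound r W B' f :=
  ⟨h.1, h.2.trans (ENNReal.coe_le_coe.2 hB)⟩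

lemma LpBound.add (hr : 1 ≤ r) (hf : LpBound r W B f) (hg : LpBound r W B' g) :
    LpBound r W (B + B') (fun z => f z + g z) :=
  ⟨hf.1.add hg.1, (eLpNorm_add_le hf.1 hg.1 hr).trans
    (ENNReal.coe_add B B' ▸ add_le_add hf.2 hg.2)⟩

lemma LpBound.comp {Φ : ST d → ST d'} {u : ST d' → F} (h : LpBound r U B u)
    (hΦ : IsPullbackMap volume volume c W U Φ) (hW : MeasurableSet W) :
    LpBound r W (c ^ (1 / r).toReal * B) (fun z => u (Φ z)) := by
  refine ⟨hΦ.aestronglyMeasurable_comp hW h.1, (hΦ.eLpNorm_comp_le hW h.1 r).trans ?_⟩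
  rw [ENNReal.coe_mul, ← ENNReal.coe_rpow_of_nonneg _ ENNReal.toReal_nonneg]
  gcongr
  exact h.2

variable [NormedSpace ℝ F] [NormedSpace ℝ F']

lemma LpBound.clm_comp (ℓ : F →L[ℝ] F') (h : LpBound r W B f) :
    LpBound r W (‖ℓ‖₊ * B) (fun z => ℓ (f z)) := by
  refine ⟨ℓ.continuous.comp_aestronglyMeasurable h.1, (eLpNorm_le_nnreal_smul_eLpNorm_of_ae_le_mul
    (.of_forall fun z => ℓ.le_opNNNorm (f z)) r).trans ?_⟩
  rw [ENNReal.smul_def, smul_eq_mul, ENNReal.coe_mul]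
  gcongr
  exact h.2

lemma LpBound.smul {h : ST d → ℝ} (hh : LpBound ⊤ W B' h) (hf : LpBound r W B f) :
    LpBound r W (B' * B) (fun z => h z • f z) := by
  refine ⟨hh.1.smul hf.1, (eLpNorm_smul_le_eLpNorm_top_mul_eLpNorm r hf.1 h).trans ?_⟩
  rw [ENNReal.coe_mul]
  exact mul_le_mul' hh.2 hf.2

variable {S : Set (Dir d)}

/-- `f` has iterated weak derivatives in the directions of `S` up to order `k`, all with `L^r(W)`
norm at most `B`. The recursion over the order, rather than a quantification over multi-indices,
makes the product and chain rules provable by induction; see `sobolevBound_iff`. -/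
def SobolevBound (S : Set (Dir d)) (r : ℝ≥0∞) (W : Set (ST d)) : ℕ → ℝ≥0 → (ST d → F) → Prop
  | 0, B, f => LpBound r W B f
  | k + 1, B, f => LpBound r W B f ∧
      ∀ e ∈ S, ∃ v, HasWeakDeriv W (dirIdx e) f v ∧ SobolevBound S r W k B v

lemma SobolevBound.lpBound (h : SobolevBound S r W k B f) : LpBound r W B f := by
  cases k with
  | zero => exact h
  | succ k => exact h.1

lemma SobolevBound.of_succ (h : SobolevBound S r W (k + 1) B f) : SobolevBound S r W k B f := by
  induction k generalizing f with
  | zero => exact h.1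
  | succ k ih => exact ⟨h.1, fun e he => (h.2 e he).imp fun v hv => ⟨hv.1, ih hv.2⟩⟩

lemma SobolevBound.mono (hB : B ≤ B') (h : SobolevBound S r W k B f) :
    SobolevBound S r W k B' f := by
  induction k generalizing f with
  | zero => exact LpBound.mono hB h
  | succ k ih => exact ⟨h.1.mono hB, fun e he => (h.2 e he).imp fun v hv => ⟨hv.1, ih hv.2⟩⟩

lemma SobolevBound.add (hr : 1 ≤ r) (hf : SobolevBound S r W k B f)
    (hg : SobolevBound S r W k B' g) : SobolevBound S r W k (B + B') (fun z => f z + g z) := by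
  induction k generalizing f g with
  | zero => exact LpBound.add hr hf hg
  | succ k ih =>
    refine ⟨hf.1.add hr hg.1, fun e he => ?_⟩
    obtain ⟨f', hff', hf'⟩ := hf.2 e he
    obtain ⟨g', hgg', hg'⟩ := hg.2 e he
    exact ⟨_, hff'.add hgg', ih hf' hg'⟩

lemma sobolevBound_zero : SobolevBound S r W k B (fun _ => (0 : F)) := by
  have lpBound : LpBound r W B (fun _ => (0 : F)) := ⟨aestronglyMeasurable_const, by simp⟩
  induction k with
  | zero => exact lpBound
  | succ k ih =>
    exact ⟨lpBound, fun _ _ => ⟨_, ⟨locallyIntegrableOn_zero, locallyIntegrableOn_zero,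
      by simp⟩, ih⟩⟩

lemma SobolevBound.sum {ι : Type*} {f : ι → ST d → F} {B : ι → ℝ≥0} (hr : 1 ≤ r) (s : Finset ι)
    (hf : ∀ j, SobolevBound S r W k (B j) (f j)) :
    SobolevBound S r W k (∑ j ∈ s, B j) (fun z => ∑ j ∈ s, f j z) := by
  induction s using Finset.cons_induction with
  | empty => simpa only [Finset.sum_empty] using sobolevBound_zero
  | cons j s hj ih => simpa only [Finset.sum_cons] using (hf j).add hr ih

lemma SobolevBound.clm_comp [CompleteSpace F] [CompleteSpace F'] (ℓ : F →L[ℝ] F')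
    (h : SobolevBound S r W k B f) : SobolevBound S r W k (‖ℓ‖₊ * B) (fun z => ℓ (f z)) := by
  induction k generalizing f with
  | zero => exact LpBound.clm_comp ℓ h
  | succ k ih =>
    refine ⟨h.1.clm_comp ℓ, fun e he => ?_⟩
    obtain ⟨v, hv, hv'⟩ := h.2 e he
    exact ⟨_, hv.clm_comp ℓ, ih hv'⟩

lemma SobolevBound.smul {h : ST d → ℝ} (hW : IsOpen W) (hr : 1 ≤ r)
    (hh : SobolevBound S ⊤ W k B' h) (hf : SobolevBound S r W k B f) :
    SobolevBound S r W k (2 ^ k * (B' * B)) (fun z => h z • f z) := by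
  induction k generalizing f h with
  | zero => simpa only [pow_zero, one_mul] using! LpBound.smul hh hf
  | succ k ih =>
    refine ⟨(hh.1.smul hf.1).mono (le_mul_of_one_le_left zero_le (one_le_pow₀ one_le_two)),
      fun e he => ?_⟩
    obtain ⟨h', hhh', hh'⟩ := hh.2 e he
    obtain ⟨f', hff', hf'⟩ := hf.2 e he
    rw [hasWeakDeriv_dirIdx_iff] at hhh' hff'
    refine ⟨_, hasWeakDeriv_dirIdx_iff.2
      (hhh'.smul_of_ae_bounded hW hff' hh.1.ae_norm_le hh'.lpBound.ae_norm_le), ?_⟩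
    convert (ih hh.of_succ hf').add hr (ih hh' hf.of_succ) using 1
    ring

lemma exists_hasWeakDeriv_comp [CompleteSpace F] {C M : ℝ≥0} {Φ Φ' : ST d → ST d'}
    {u : ST d' → F} {e : Dir d} (hW : IsOpen W) (hU : IsOpen U) (hr : 1 ≤ r)
    (hΦ : IsPullbackMap volume volume c W U Φ)
    (hcomp : ∀ w : ST d' → F, SobolevBound univ r U k B w →
      SobolevBound S r W k (C * B) (fun z => w (Φ z)))
    (hΦM : LpBound ⊤ W M Φ) (hΦ' : HasWeakDeriv W (dirIdx e) Φ Φ')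
    (hΦ'M : SobolevBound S ⊤ W k M Φ') (hu : SobolevBound univ r U (k + 1) B u) :
    ∃ v, HasWeakDeriv W (dirIdx e) (fun z => u (Φ z)) v ∧
      SobolevBound S r W k ((∑ j : Dir d', 2 ^ k * (‖dirCoord j‖₊ * M * C)) * B) v := by
  choose w huw hw using fun j => hu.2 j (mem_univ j)
  rw [hasWeakDeriv_dirIdx_iff] at hΦ'
  refine ⟨fun z => ∑ j, dirCoord j (Φ' z) • w j (Φ z), hasWeakDeriv_dirIdx_iff.2 ?_, ?_⟩
  · exact hΦ'.comp sum_dirCoord_smul_dirVec hW hU hΦ (hu.1.locallyIntegrableOn hr)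
      (fun j => hasWeakDeriv_dirIdx_iff.1 (huw j)) hΦM.ae_norm_le hΦ'M.lpBound.ae_norm_le
  · simp only [Finset.sum_mul, mul_assoc]
    simpa only [mul_assoc] using SobolevBound.sum hr Finset.univ fun j =>
      (hΦ'M.clm_comp (dirCoord j)).smul hW hr (hcomp _ (hw j))

theorem exists_sobolevBound_comp (F : Type*) [NormedAddCommGroup F] [NormedSpace ℝ F]
    [CompleteSpace F] (hr : 1 ≤ r) (S : Set (Dir d)) (d' : ℕ) (c M : ℝ≥0) (k : ℕ) :
    ∃ C : ℝ≥0, ∀ (W : Set (ST d)) (U : Set (ST d')) (Φ : ST d → ST d'), IsOpen W → IsOpen U →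
      IsPullbackMap volume volume c W U Φ → SobolevBound S ⊤ W k M Φ →
      ∀ (B : ℝ≥0) (u : ST d' → F), SobolevBound univ r U k B u →
        SobolevBound S r W k (C * B) (fun z => u (Φ z)) := by
  induction k with
  | zero => exact ⟨_, fun W U Φ hW _ hΦ _ B u hu => LpBound.comp hu hΦ hW.measurableSet⟩
  | succ k ih =>
    obtain ⟨C, hC⟩ := ih
    refine ⟨c ^ (1 / r).toReal + ∑ j : Dir d', 2 ^ k * (‖dirCoord j‖₊ * M * C),
      fun W U Φ hW hU hΦ hΦM B u hu => ⟨?_, fun e he => ?_⟩⟩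
    · exact (hu.1.comp hΦ hW.measurableSet).mono (by gcongr; exact le_self_add)
    · obtain ⟨Φ', hΦ', hΦ'M⟩ := hΦM.2 e he
      obtain ⟨v, hv, hvB⟩ := exists_hasWeakDeriv_comp hW hU hr hΦ
        (hC W U Φ hW hU hΦ hΦM.of_succ B) hΦM.1 hΦ' hΦ'M hu
      exact ⟨v, hv, hvB.mono (by gcongr; exact le_add_self)⟩

end SobolevBounds

section IndexSets

variable {d k l m : ℕ} {S : Set (Dir d)} {a : MIdx d}

/-- The multi-indices of total order at most `k` that involve only the directions in `S`. -/
def supportedIdx (S : Set (Dir d)) (k : ℕ) : Set (MIdx d) :=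
  {a | (∀ e ∉ S, dirDegree a e = 0) ∧ totalOrder a ≤ k}

lemma totalOrder_eq_zero : totalOrder a = 0 ↔ a = 0 := by
  refine ⟨fun h => dirDegree_injective (funext fun e => ?_), by rintro rfl; exact totalOrder_zero⟩
  rw [totalOrder_eq_sum_dirDegree, Finset.sum_eq_zero_iff] at h
  exact (h e (Finset.mem_univ e)).trans (by cases e <;> rfl)

lemma zero_mem_supportedIdx : (0 : MIdx d) ∈ supportedIdx S k :=
  ⟨fun e _ => by cases e <;> rfl, by simp only [totalOrder_zero, zero_le]⟩

lemma supportedIdx_zero : supportedIdx S 0 = {0} := by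
  ext a
  exact ⟨fun h => totalOrder_eq_zero.1 (Nat.le_zero.1 h.2),
    by rintro rfl; exact zero_mem_supportedIdx⟩

lemma dirIdx_le {e : Dir d} (h : dirDegree a e ≠ 0) : dirIdx e ≤ a := by
  cases e with
  | none => exact ⟨zero_le, Nat.one_le_iff_ne_zero.2 h⟩
  | some i => exact ⟨update_le_iff.2 ⟨Nat.one_le_iff_ne_zero.2 h, fun _ _ => zero_le⟩, zero_le⟩

lemma mem_supportedIdx_succ :
    a ∈ supportedIdx S (k + 1) ↔ a = 0 ∨ ∃ e ∈ S, ∃ b ∈ supportedIdx S k, a = dirIdx e + b := by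
  refine ⟨fun ⟨hS, hk⟩ => or_iff_not_imp_left.2 fun ha => ?_, ?_⟩
  · obtain ⟨e, he⟩ : ∃ e, dirDegree a e ≠ 0 := by
      contrapose! ha
      rw [← totalOrder_eq_zero, totalOrder_eq_sum_dirDegree, Finset.sum_congr rfl fun e _ => ha e,
        Finset.sum_const_zero]
    obtain ⟨b, rfl⟩ := exists_add_of_le (dirIdx_le he)
    refine ⟨e, not_imp_comm.1 (hS e) he, b, ⟨fun e' he' => ?_, ?_⟩, rfl⟩
    · exact (Nat.add_eq_zero_iff.1 (dirDegree_add (dirIdx e) b ▸ hS e' he')).2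
    · rw [totalOrder_add, totalOrder_dirIdx] at hk
      omega
  · rintro (rfl | ⟨e, he, b, ⟨hS, hk⟩, rfl⟩)
    · exact zero_mem_supportedIdx
    · refine ⟨fun e' he' => ?_, ?_⟩
      · rw [dirDegree_add, dirDegree_dirIdx, Pi.add_apply, hS e' he', add_zero,
          Pi.single_eq_of_ne (ne_of_mem_of_not_mem he he').symm]
      · rw [totalOrder_add, totalOrder_dirIdx]
        omega

lemma natCast_div_le_one_iff {p q : ℕ} : (p : ℝ≥0∞) / q ≤ 1 ↔ p ≤ q := by
  rw [ENNReal.div_le_iff_le_mul (.inr ENNReal.one_ne_top) (.inr one_ne_zero), one_mul,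
    Nat.cast_le]

lemma apply_le_spaceOrder (i : Fin d) : a.1 i ≤ spaceOrder a :=
  Finset.single_le_sum (f := a.1) (fun _ _ => zero_le) (Finset.mem_univ i)

lemma mem_anisoIdx :
    a ∈ anisoIdx d k l ↔ (spaceOrder a : ℝ≥0∞) / k + (a.2 : ℝ≥0∞) / l ≤ 1 := by
  simp only [anisoIdx, Finset.mem_filter, Finset.mem_product, Fintype.mem_piFinset,
    Finset.mem_range, Nat.lt_succ_iff]
  refine ⟨And.right, fun h => ⟨⟨fun i => (apply_le_spaceOrder i).trans ?_, ?_⟩, h⟩⟩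
  · exact natCast_div_le_one_iff.1 (le_self_add.trans h)
  · exact natCast_div_le_one_iff.1 (le_add_self.trans h)

lemma mem_isoIdx : a ∈ isoIdx d m ↔ totalOrder a ≤ m := by
  simp only [isoIdx, Finset.mem_filter, Finset.mem_product, Fintype.mem_piFinset,
    Finset.mem_range, Nat.lt_succ_iff]
  refine ⟨And.right, fun h => ⟨⟨fun i => (apply_le_spaceOrder i).trans ?_, ?_⟩, h⟩⟩
  · exact le_self_add.trans h
  · exact le_add_self.trans h

lemma coe_isoIdx (d m : ℕ) : (isoIdx d m : Set (MIdx d)) = supportedIdx univ m := by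
  ext a
  simp [mem_isoIdx, supportedIdx]

lemma natCast_div_zero_add_le_one_iff {p q : ℕ} :
    (p : ℝ≥0∞) / (0 : ℕ) + (q : ℝ≥0∞) / l ≤ 1 ↔ p = 0 ∧ p + q ≤ l := by
  constructor
  · intro h
    obtain rfl : p = 0 := Nat.le_zero.1 (natCast_div_le_one_iff.1 (le_self_add.trans h))
    exact ⟨rfl, (zero_add q).trans_le (natCast_div_le_one_iff.1 (le_add_self.trans h))⟩
  · rintro ⟨rfl, h⟩
    rwa [Nat.cast_zero, ENNReal.zero_div, zero_add, natCast_div_le_one_iff, ← zero_add q]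

lemma coe_anisoIdx_zero_left (d l : ℕ) :
    (anisoIdx d 0 l : Set (MIdx d)) = supportedIdx {none} l := by
  ext a
  rw [Finset.mem_coe, mem_anisoIdx, natCast_div_zero_add_le_one_iff]
  simp [supportedIdx, totalOrder, spaceOrder, dirDegree, Option.forall]

lemma coe_anisoIdx_zero_right (d k : ℕ) :
    (anisoIdx d k 0 : Set (MIdx d)) = supportedIdx (range some) k := by
  ext a
  rw [Finset.mem_coe, mem_anisoIdx, add_comm, natCast_div_zero_add_le_one_iff, add_comm]
  simp [supportedIdx, totalOrder, dirDegree, Option.forall]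

end IndexSets

section SquareSums

lemma le_sum_sq_rpow_half {ι : Type*} {s : Finset ι} {x : ι → ℝ≥0∞} {i : ι} (hi : i ∈ s) :
    x i ≤ (∑ i ∈ s, x i ^ 2) ^ (1 / 2 : ℝ) := by
  rw [one_div, ENNReal.le_rpow_inv_iff two_pos, ENNReal.rpow_two]
  exact Finset.single_le_sum (f := fun i => x i ^ 2) (fun _ _ => zero_le) hi

lemma sum_sq_rpow_half_le {ι : Type*} (s : Finset ι) {x : ι → ℝ≥0∞} {b : ℝ≥0∞}
    (h : ∀ i ∈ s, x i ≤ b) :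
    (∑ i ∈ s, x i ^ 2) ^ (1 / 2 : ℝ) ≤ NNReal.sqrt s.card * b := by
  calc (∑ i ∈ s, x i ^ 2) ^ (1 / 2 : ℝ) ≤ (s.card * b ^ 2) ^ (1 / 2 : ℝ) := by
        gcongr
        rw [← nsmul_eq_mul]
        exact Finset.sum_le_card_nsmul s _ (b ^ 2) fun i hi => by gcongr; exact h i hi
    _ = NNReal.sqrt s.card * b := by
        rw [ENNReal.mul_rpow_of_nonneg _ _ (by norm_num), ← ENNReal.rpow_natCast,
          ← ENNReal.rpow_mul, NNReal.sqrt_eq_rpow, ENNReal.coe_rpow_of_nonneg _ (by norm_num)]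
        norm_num

end SquareSums

section WeakDerivNorms

variable {d : ℕ} {F : Type*} [NormedAddCommGroup F] [NormedSpace ℝ F] {r : ℝ≥0∞}
  {W : Set (ST d)} {S : Set (Dir d)} {I : Finset (MIdx d)} {B : ℝ≥0} {k : ℕ} {a b : MIdx d}
  {f g g' : ST d → F}

lemma HasWeakDeriv.weakDerivNorm_add (h : HasWeakDeriv W a f g) :
    weakDerivNorm r W (a + b) f = weakDerivNorm r W b g :=
  iInf_congr fun _ => iInf_congr_Prop ⟨h.of_add, h.trans⟩ fun _ => rfl

lemma HasWeakDeriv.normLinf_eq (h : HasWeakDeriv W a f g) (h' : HasWeakDeriv W a f g') :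
    normLinf I W g = normLinf I W g' := by
  simp only [normLinf, ← h.weakDerivNorm_add, ← h'.weakDerivNorm_add]

lemma exists_hasWeakDeriv_of_weakDerivNorm_le (h : weakDerivNorm r W a f ≤ B) :
    ∃ v, HasWeakDeriv W a f v := by
  obtain ⟨v, hv⟩ := iInf_lt_iff.1 (h.trans_lt ENNReal.coe_lt_top)
  exact ⟨v, (iInf_lt_iff.1 hv).1⟩

lemma exists_hasWeakDeriv_normLinf_le
    (h : ⨅ (v : ST d → F) (_ : HasWeakDeriv W a f v), normLinf I W v ≤ B) :
    ∃ v, HasWeakDeriv W a f v ∧ normLinf I W v ≤ B := by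
  obtain ⟨v, hv⟩ := iInf_lt_iff.1 (h.trans_lt ENNReal.coe_lt_top)
  obtain ⟨hv, -⟩ := iInf_lt_iff.1 hv
  exact ⟨v, hv, (le_iInf₂ fun _ hw => (hv.normLinf_eq hw).le).trans h⟩

variable [CompleteSpace F]

lemma lpBound_iff_weakDerivNorm_zero_le (hW : IsOpen W) (hr : 1 ≤ r) :
    LpBound r W B f ↔ weakDerivNorm r W 0 f ≤ B := by
  constructor
  · exact fun h => (iInf₂_le f (hasWeakDeriv_zero_self (h.locallyIntegrableOn hr))).trans h.2
  · intro h
    obtain ⟨v, hv⟩ := exists_hasWeakDeriv_of_weakDerivNorm_le h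
    have self := hasWeakDeriv_zero_self hv.1
    exact ⟨hv.1.aestronglyMeasurable,
      (le_iInf₂ fun w hw => (eLpNorm_congr_ae (self.ae_eq hW hw)).le).trans h⟩

lemma sobolevBound_iff (hW : IsOpen W) (hr : 1 ≤ r) :
    SobolevBound S r W k B f ↔ ∀ b ∈ supportedIdx S k, weakDerivNorm r W b f ≤ B := by
  induction k generalizing f with
  | zero =>
    simp only [supportedIdx_zero, mem_singleton_iff, forall_eq]
    exact lpBound_iff_weakDerivNorm_zero_le hW hr
  | succ k ih =>
    simp only [mem_supportedIdx_succ, or_imp, forall_and, forall_eq, forall_exists_index, and_imp]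
    refine and_congr (lpBound_iff_weakDerivNorm_zero_le hW hr) ⟨?_, fun h e he => ?_⟩
    · rintro h _ e he b hb rfl
      obtain ⟨v, hv, hvB⟩ := h e he
      exact hv.weakDerivNorm_add.trans_le (ih.1 hvB b hb)
    · obtain ⟨v, hv⟩ := exists_hasWeakDeriv_of_weakDerivNorm_le
        (h _ e he 0 zero_mem_supportedIdx (add_zero _).symm)
      exact ⟨v, hv, ih.2 fun b hb => hv.weakDerivNorm_add.symm.trans_le (h _ e he b hb rfl)⟩

lemma normLinf_le_iff_sobolevBound (hI : I = supportedIdx S k) (hW : IsOpen W) :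
    normLinf I W f ≤ B ↔ SobolevBound S ⊤ W k B f := by
  rw [sobolevBound_iff hW le_top, ← hI, normLinf, Finset.sup_le_iff]
  rfl

lemma SobolevBound.normL2_le (hI : I = supportedIdx S k) (hW : IsOpen W)
    (h : SobolevBound S 2 W k B f) : normL2 I W f ≤ (NNReal.sqrt I.card * B : ℝ≥0) := by
  rw [ENNReal.coe_mul]
  exact sum_sq_rpow_half_le I fun a ha => (sobolevBound_iff hW one_le_two).1 h a (hI ▸ ha)

lemma sobolevBound_of_normL2_le (hI : I = supportedIdx S k) (hW : IsOpen W)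
    (h : normL2 I W f ≤ B) : SobolevBound S 2 W k B f :=
  (sobolevBound_iff hW one_le_two).2 fun a ha =>
    (le_sum_sq_rpow_half (x := fun a => weakDerivNorm 2 W a f) (by rwa [← hI] at ha)).trans h

end WeakDerivNorms

section Composition

-- The constant is `C + 1` because `0 * ⊤ = 0`.
lemma le_coe_add_one_mul_of_forall_coe_le {C : ℝ≥0} {x y : ℝ≥0∞}
    (h : ∀ b : ℝ≥0, y ≤ b → x ≤ (C * b : ℝ≥0)) : x ≤ (C + 1 : ℝ≥0) * y := by
  obtain rfl | hy := eq_or_ne y ⊤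
  · rw [ENNReal.mul_top (ENNReal.coe_ne_zero.2 (by positivity))]
    exact le_top
  · lift y to ℝ≥0 using hy
    rw [← ENNReal.coe_mul]
    exact (h y le_rfl).trans (by gcongr; exact le_self_add)

variable {d m : ℕ} (F : Type*) [NormedAddCommGroup F] [NormedSpace ℝ F] [CompleteSpace F]
  {S : Set (Dir d)} {I : Finset (MIdx d)}

theorem exists_normL2_comp_le (hI : I = supportedIdx S m) (d' : ℕ) (c M : ℝ≥0) :
    ∃ C : ℝ≥0, ∀ (W : Set (ST d)) (U : Set (ST d')) (Φ : ST d → ST d') (u : ST d' → F),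
      IsOpen W → IsOpen U → IsPullbackMap volume volume c W U Φ → normLinf I W Φ ≤ M →
      normL2 I W (u ∘ Φ) ≤ C * normL2 (isoIdx d' m) U u := by
  obtain ⟨C, hC⟩ := exists_sobolevBound_comp F one_le_two S d' c M m
  refine ⟨NNReal.sqrt I.card * C + 1, fun W U Φ u hW hU hΦ hM =>
    le_coe_add_one_mul_of_forall_coe_le fun B hB => ?_⟩
  rw [mul_assoc]
  exact (hC W U Φ hW hU hΦ ((normLinf_le_iff_sobolevBound hI hW).1 hM) B u
    (sobolevBound_of_normL2_le (coe_isoIdx d' m) hU hB)).normL2_le hI hW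

theorem exists_normL2_deriv_comp_le (hI : I = supportedIdx S m) (d' : ℕ) (c M : ℝ≥0) :
    ∃ C : ℝ≥0, ∀ (W : Set (ST d)) (U : Set (ST d')) (Φ : ST d → ST d') (u : ST d' → F)
      (e : Dir d), IsOpen W → IsOpen U → IsPullbackMap volume volume c W U Φ →
      normLinf I W Φ ≤ M →
      ⨅ (Φ' : ST d → ST d') (_ : HasWeakDeriv W (dirIdx e) Φ Φ'), normLinf I W Φ' ≤ M →
      ⨅ (v : ST d → F) (_ : HasWeakDeriv W (dirIdx e) (u ∘ Φ) v), normL2 I W v ≤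
        C * normL2 (isoIdx d' (m + 1)) U u := by
  obtain ⟨C, hC⟩ := exists_sobolevBound_comp F one_le_two S d' c M m
  refine ⟨NNReal.sqrt I.card * (∑ j : Dir d', 2 ^ m * (‖dirCoord j‖₊ * M * C)) + 1,
    fun W U Φ u e hW hU hΦ hM hM' => le_coe_add_one_mul_of_forall_coe_le fun B hB => ?_⟩
  obtain ⟨Φ', hΦ', hΦ'M⟩ := exists_hasWeakDeriv_normLinf_le hM'
  have hΦM := (normLinf_le_iff_sobolevBound hI hW).1 hM
  obtain ⟨v, hv, hvB⟩ := exists_hasWeakDeriv_comp hW hU one_le_two hΦ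
    (hC W U Φ hW hU hΦ hΦM B) hΦM.lpBound hΦ' ((normLinf_le_iff_sobolevBound hI hW).1 hΦ'M)
    (sobolevBound_of_normL2_le (coe_isoIdx d' (m + 1)) hU hB)
  rw [mul_assoc]
  exact (iInf₂_le v hv).trans (hvB.normL2_le hI hW)

end Composition

end AnisoSobolev

open AnisoSobolev in
theorem mainTheorem9_general (F : Type*) [NormedAddCommGroup F] [NormedSpace ℝ F] [CompleteSpace F]
    (d ls lt : ℕ) (M L : ℝ≥0) :
    (∃ C : ℝ≥0, ∀ (E : Set (ST d)) (Ψ : ST d → EuclideanSpace ℝ (Fin d)) (u : ST d → F),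
      IsDeformation L E Ψ →
      normHinf 0 lt E (spaceTimeMap Ψ) ≤ M →
      normL2 (anisoIdx d 0 lt) E (u ∘ spaceTimeMap Ψ) ≤
        C * normL2 (isoIdx d lt) (spaceTimeMap Ψ '' E) u) ∧
    (∃ C : ℝ≥0, ∀ (E : Set (ST d)) (Ψ : ST d → EuclideanSpace ℝ (Fin d)) (u : ST d → F),
      IsDeformation L E Ψ →
      normHinf ls 0 E (spaceTimeMap Ψ) ≤ M →
      normL2 (anisoIdx d ls 0) E (u ∘ spaceTimeMap Ψ) ≤
        C * normL2 (isoIdx d ls) (spaceTimeMap Ψ '' E) u) ∧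
    (∃ C : ℝ≥0, ∀ (E : Set (ST d)) (Ψ : ST d → EuclideanSpace ℝ (Fin d)) (u : ST d → F),
      IsDeformation L E Ψ →
      normHinf ls 0 E (spaceTimeMap Ψ) + normHinfDt ls 0 E (spaceTimeMap Ψ) ≤ M →
      ⨅ (v : ST d → F) (_ : HasWeakDeriv E (idxT d) (u ∘ spaceTimeMap Ψ) v),
        normL2 (anisoIdx d ls 0) E v ≤ C * normL2 (isoIdx d (ls + 1)) (spaceTimeMap Ψ '' E) u) ∧
    (∃ C : ℝ≥0, ∀ (E : Set (ST d)) (Ψ : ST d → EuclideanSpace ℝ (Fin d)) (u : ST d → F),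
      IsDeformation L E Ψ →
      normHinf 0 lt E (spaceTimeMap Ψ) + normHinfGrad 0 lt E (spaceTimeMap Ψ) ≤ M →
      (∑ i : Fin d, (⨅ (v : ST d → F) (_ : HasWeakDeriv E (idxX i) (u ∘ spaceTimeMap Ψ) v),
        normL2 (anisoIdx d 0 lt) E v) ^ 2) ^ (1 / 2 : ℝ) ≤
        C * normL2 (isoIdx d (lt + 1)) (spaceTimeMap Ψ '' E) u) := by
  refine ⟨?_, ?_, ?_, ?_⟩
  · obtain ⟨C, hC⟩ := exists_normL2_comp_le F (coe_anisoIdx_zero_left d lt) d (L ^ d) M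
    exact ⟨C, fun E Ψ u h => hC _ _ _ u h.isOpen_domain h.isOpen_image h.isPullbackMap⟩
  · obtain ⟨C, hC⟩ := exists_normL2_comp_le F (coe_anisoIdx_zero_right d ls) d (L ^ d) M
    exact ⟨C, fun E Ψ u h => hC _ _ _ u h.isOpen_domain h.isOpen_image h.isPullbackMap⟩
  · obtain ⟨C, hC⟩ := exists_normL2_deriv_comp_le F (coe_anisoIdx_zero_right d ls) d (L ^ d) M
    exact ⟨C, fun E Ψ u h hM => hC _ _ _ u none h.isOpen_domain h.isOpen_image h.isPullbackMap
      (le_self_add.trans hM) (le_add_self.trans hM)⟩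
  · obtain ⟨C, hC⟩ := exists_normL2_deriv_comp_le F (coe_anisoIdx_zero_left d lt) d (L ^ d) M
    refine ⟨NNReal.sqrt (Finset.univ : Finset (Fin d)).card * C, fun E Ψ u h hM => ?_⟩
    rw [ENNReal.coe_mul, mul_assoc]
    refine sum_sq_rpow_half_le Finset.univ fun i hi => hC _ _ _ u (some i) h.isOpen_domain
      h.isOpen_image h.isPullbackMap (le_self_add.trans hM) ?_
    exact (Finset.sup_le_iff.1 (le_add_self.trans hM) : ∀ i ∈ Finset.univ, _) i hi

open AnisoSobolev in
theorem mainTheorem9 (d ls lt : ℕ) (M L : ℝ≥0) :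
    (∃ C : ℝ≥0, ∀ (E : Set (ST d)) (Ψ : ST d → EuclideanSpace ℝ (Fin d)) (u : ST d → ℝ),
      IsDeformation L E Ψ →
      normHinf 0 lt E (spaceTimeMap Ψ) ≤ M →
      normHaniso 0 lt E (u ∘ spaceTimeMap Ψ) ≤ C * normH lt (spaceTimeMap Ψ '' E) u) ∧
    (∃ C : ℝ≥0, ∀ (E : Set (ST d)) (Ψ : ST d → EuclideanSpace ℝ (Fin d)) (u : ST d → ℝ),
      IsDeformation L E Ψ →
      normHinf ls 0 E (spaceTimeMap Ψ) ≤ M →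
      normHaniso ls 0 E (u ∘ spaceTimeMap Ψ) ≤ C * normH ls (spaceTimeMap Ψ '' E) u) ∧
    (∃ C : ℝ≥0, ∀ (E : Set (ST d)) (Ψ : ST d → EuclideanSpace ℝ (Fin d)) (u : ST d → ℝ),
      IsDeformation L E Ψ →
      normHinf ls 0 E (spaceTimeMap Ψ) + normHinfDt ls 0 E (spaceTimeMap Ψ) ≤ M →
      normHanisoDt ls 0 E (u ∘ spaceTimeMap Ψ) ≤ C * normH (ls + 1) (spaceTimeMap Ψ '' E) u) ∧
    (∃ C : ℝ≥0, ∀ (E : Set (ST d)) (Ψ : ST d → EuclideanSpace ℝ (Fin d)) (u : ST d → ℝ),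
      IsDeformation L E Ψ →
      normHinf 0 lt E (spaceTimeMap Ψ) + normHinfGrad 0 lt E (spaceTimeMap Ψ) ≤ M →
      normHanisoGrad 0 lt E (u ∘ spaceTimeMap Ψ) ≤ C * normH (lt + 1) (spaceTimeMap Ψ '' E) u) :=
  mainTheorem9_general ℝ d ls lt M L
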